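/- A \emph{multiring} is a set $A$ with a commutative monoid structure $(A,\cdot,1)$, an element $0$ with $a\cdot 0=0$, a map $-\colon A\to A$ and a multivalued sum assigning to $a,b\in A$ a non-empty set $a+b\subseteq A$, such that for all $a,b,c,d,g,x\in A$: $a\in b+c$ implies $c\in -b+a$ and $b\in a+(-c)$; $a\in b+0$ iff $a=b$; if $x\in g+c$ and $g\in a+b$, then $x\in a+h$ for some $h\in b+c$; $a+b=b+a$; and $a\in b+c$ implies $ad\in bd+cd$. A morphism is a map preserving $\cdot,-,0,1$ and such that $a\in b+c$ implies $f(a)\in f(b)+f(c)$; an isomorphism is a morphism with a two-sided inverse morphism. $A$ is \emph{semi-real} if $-1\notin a_1^2+\dots+a_n^2$ for all $a_1,\dots,a_n\in A$. Let $\mathbf 3=\{-1,0,1\}$ be the sign hyperfield (usual product, $0+x=\{x\}$, $1+1=\{1\}$, $(-1)+(-1)=\{-1\}$, $1+(-1)=\mathbf 3$) and let $\mathrm{sper}(A)$ be the set of morphisms $A\to\mathbf 3$. The \emph{real reduced quotient} $Q(A)$ is the set of functions $\hat a\colon \mathrm{sper}(A)\to\mathbf 3$, $\hat a(\sigma)=\sigma(a)$,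 for $a\in A$, with product $\hat a\hat b=\widehat{ab}$, opposite $-\hat a=\widehat{-a}$, constants $\hat 0,\hat 1$, and $\hat a\in\hat b+\hat c$ iff there are $a',b',c'\in A$ with $\hat a'=\hat a$, $\hat b'=\hat b$, $\hat c'=\hat c$ and $a'\in b'+c'$; let $\pi_A\colon A\to Q(A)$, $a\mapsto\hat a$. An ideal of $A$ is a subset containing $0$ and closed under sums and under multiplication by elements of $A$; it is prime if it does not contain $1$ and contains $a$ or $b$ whenever it contains $ab$. Let $\mathrm{spec}(A)$ be the set of prime ideals with the constructible topology, that is, the topology generated by the sets $D(a)=\{p : a\notin p\}$ and their complements. For $p\in\mathrm{spec}(A)$ let $K_A(p)$ be the hyperfield of fractions of $A/p$ (in $A/p$, $a\sim b$ iff $(a+(-b))\cap p\ne\emptyset$, and sums are computed on representatives; in a localization $S^{-1}M$, $a/s=b/t$ iff $atu=bsu$ for some $u\in S$, and $a/s\in b/t+c/u$ iff $atuv\in bsuv+cstv$ for some $v\in S$). The \emph{von Neumann hull} $V(A)$ is the set of families $(s(p))_{p\in\mathrm{spec}(A)}$, $s(p)\in K_A(p)$, such that every $p$ has a clopen neighbourhood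 $U$ and $x,y\in A$ with $U\subseteq D(y)$ and $s(q)=x/y$ in $K_A(q)$ for all $q\in U$, with all operations pointwise; in particular $r\in s+t$ iff $r(p)\in s(p)+t(p)$ for all $p$. A morphism $f\colon A\to B$ induces $V(f)\colon V(A)\to V(B)$, where $V(f)(s)(p)$ is the image of $s(f^{-1}(p))$ under the map $K_A(f^{-1}(p))\to K_B(p)$, $x/y\mapsto f(x)/f(y)$. \textbf{Theorem.} Let $A$ be a semi-real multiring. Then $Q(A)$, $V(A)$, $Q(V(A))$ and $V(Q(A))$ are multirings, $V(A)$ is semi-real, and there is exactly one morphism $f\colon Q(V(A))\to V(Q(A))$ with $f\circ\pi_{V(A)}=V(\pi_A)$; this morphism is an isomorphism of multirings. -/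

import Mathlib

universe u v

/-! ### Multirings -/

/-- The operations of a multiring: a commutative multiplicative monoid with zero, an opposite map,
and a multivalued sum `hadd a b`, the set `a + b`. -/
class MultiringStr (A : Type u) extends CommMonoidWithZero A, Neg A where
  hadd : A → A → Set A

infixl:65 " +ₘ " => MultiringStr.hadd

/-- The axioms of a multiring (commutativity, associativity and unit of the product, and
`a * 0 = 0`, are part of `CommMonoidWithZero`). -/
class IsMultiring (A : Type u) [MultiringStr A] : Prop where
  hadd_nonempty : ∀ a b : A, (a +ₘ b).Nonempty
  mem_neg_hadd : ∀ a b c : A, a ∈ b +ₘ c → c ∈ (-b) +ₘ a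
  mem_hadd_neg : ∀ a b c : A, a ∈ b +ₘ c → b ∈ a +ₘ (-c)
  mem_hadd_zero : ∀ a b : A, a ∈ b +ₘ 0 ↔ a = b
  hadd_assoc : ∀ a b c g x : A, x ∈ g +ₘ c → g ∈ a +ₘ b → ∃ h ∈ b +ₘ c, x ∈ a +ₘ h
  hadd_comm : ∀ a b : A, a +ₘ b = b +ₘ a
  mul_mem_hadd : ∀ a b c d : A, a ∈ b +ₘ c → a * d ∈ (b * d) +ₘ (c * d)

/-- Morphisms of multirings. -/
structure MultiringHom (A : Type u) (B : Type v) [MultiringStr A] [MultiringStr B] where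
  toFun : A → B
  map_hadd : ∀ a b c, a ∈ b +ₘ c → toFun a ∈ toFun b +ₘ toFun c
  map_mul : ∀ a b, toFun (a * b) = toFun a * toFun b
  map_zero : toFun 0 = 0
  map_one : toFun 1 = 1
  map_neg : ∀ a, toFun (-a) = -toFun a

instance {A : Type u} {B : Type v} [MultiringStr A] [MultiringStr B] :
    CoeFun (MultiringHom A B) (fun _ => A → B) := ⟨MultiringHom.toFun⟩

/-- An isomorphism is a morphism that has a two-sided inverse morphism. -/
def MultiringHom.IsIso {A : Type u} {B : Type v} [MultiringStr A] [MultiringStr B]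
    (f : MultiringHom A B) : Prop :=
  ∃ g : MultiringHom B A, (∀ a, g (f a) = a) ∧ ∀ b, f (g b) = b

/-! ### Orders, semi-real multirings and the real reduced quotient -/

/-- The sign hyperfield `{-1, 0, 1}`: `0 + x = x + 0 = {x}`, `x + x = {x}` and
`1 + (-1) = (-1) + 1 = {-1, 0, 1}`. -/
instance : MultiringStr SignType where
  hadd a b := if a = 0 then {b} else if b = 0 then {a} else if a = b then {a} else Set.univ

instance : IsMultiring SignType := by
  have key : ∀ a b c : SignType, a ∈ b +ₘ c ↔
      if b = 0 then a = c else if c = 0 then a = b else if b = c then a = b else True := by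
    intro a b c
    change a ∈ (if b = 0 then {c} else if c = 0 then {b} else if b = c then {b} else Set.univ :
      Set SignType) ↔ _
    split_ifs <;> simp
  refine ⟨?_, ?_, ?_, ?_, ?_, ?_, ?_⟩ <;> simp only [Set.Nonempty, Set.ext_iff, key] <;> decide

/-- The real spectrum: orders of `A` are morphisms from `A` to the sign hyperfield. -/
abbrev RealSpec (A : Type u) [MultiringStr A] : Type u := MultiringHom A SignType

/-- The multivalued sum `x₁ + (x₂ + (⋯ + xₙ))` (the empty sum is `{0}`). -/
def listSum {A : Type u} [MultiringStr A] : List A → Set A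
  | [] => {0}
  | x :: l => {y | ∃ z ∈ listSum l, y ∈ x +ₘ z}

/-- `A` is semi-real if `-1` belongs to no finite sum of squares. -/
def SemiReal (A : Type u) [MultiringStr A] : Prop :=
  ∀ l : List A, (-1 : A) ∉ listSum (l.map (fun a => a ^ 2))

/-- The real reduced quotient `Q(A)`: the set of functions `σ ↦ σ a` on the real spectrum. -/
@[ext]
structure RRQuot (A : Type u) [MultiringStr A] : Type u where
  val : RealSpec A → SignType
  exists_rep : ∃ a : A, ∀ σ : RealSpec A, val σ = σ a

namespace RRQuot

variable {A : Type u} [MultiringStr A]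

/-- The class `â` of `a`. -/
def mk' (a : A) : RRQuot A := ⟨fun σ => σ a, a, fun _ => rfl⟩

/-- The operations are computed on representatives; the sum is
`â ∈ b̂ + ĉ` iff `a' ∈ b' + c'` for some representatives `a', b', c'`. -/
instance : MultiringStr (RRQuot A) where
  mul x y := ⟨fun σ => x.val σ * y.val σ, by
    obtain ⟨a, ha⟩ := x.exists_rep
    obtain ⟨b, hb⟩ := y.exists_rep
    exact ⟨a * b, fun σ => by rw [σ.map_mul, ha, hb]⟩⟩
  one := mk' 1
  zero := mk' 0
  neg x := ⟨fun σ => -x.val σ, by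
    obtain ⟨a, ha⟩ := x.exists_rep
    exact ⟨-a, fun σ => by rw [σ.map_neg, ha]⟩⟩
  mul_assoc x y z := RRQuot.ext (funext fun σ => mul_assoc _ _ _)
  mul_comm x y := RRQuot.ext (funext fun σ => mul_comm _ _)
  one_mul x := RRQuot.ext (funext fun σ => by
    change σ 1 * x.val σ = x.val σ
    rw [σ.map_one, one_mul])
  mul_one x := RRQuot.ext (funext fun σ => by
    change x.val σ * σ 1 = x.val σ
    rw [σ.map_one, mul_one])
  zero_mul x := RRQuot.ext (funext fun σ => by
    change σ 0 * x.val σ = σ 0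
    rw [σ.map_zero, zero_mul])
  mul_zero x := RRQuot.ext (funext fun σ => by
    change x.val σ * σ 0 = σ 0
    rw [σ.map_zero, mul_zero])
  hadd x y := {z | ∃ a b c : A, mk' a = z ∧ mk' b = x ∧ mk' c = y ∧ a ∈ b +ₘ c}

/-- The canonical projection `π_A : A → Q(A)`. -/
def proj (A : Type u) [MultiringStr A] : MultiringHom A (RRQuot A) where
  toFun := mk'
  map_hadd a b c h := ⟨a, b, c, rfl, rfl, rfl, h⟩
  map_mul a b := RRQuot.ext (funext fun σ => σ.map_mul a b)
  map_zero := rfl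
  map_one := rfl
  map_neg a := RRQuot.ext (funext fun σ => σ.map_neg a)

end RRQuot

/-! ### Elementary facts on multirings -/

namespace IsMultiring

variable {A : Type u} [MultiringStr A] [IsMultiring A]

theorem zero_mem (a : A) : (0 : A) ∈ a +ₘ (-a) := by
  have h := mem_neg_hadd a a 0 ((mem_hadd_zero a a).2 rfl)
  rwa [hadd_comm] at h

theorem eq_neg_of_zero_mem {a b : A} (h : (0 : A) ∈ a +ₘ b) : b = -a :=
  (mem_hadd_zero _ _).1 (mem_neg_hadd _ _ _ h)

theorem neg_neg' (a : A) : -(-a) = a := by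
  have h := zero_mem a
  rw [hadd_comm] at h
  exact (eq_neg_of_zero_mem h).symm

theorem neg_zero' : -(0 : A) = 0 :=
  (eq_neg_of_zero_mem ((mem_hadd_zero (0 : A) 0).2 rfl)).symm

theorem neg_mul' (a b : A) : -a * b = -(a * b) := by
  have h := mul_mem_hadd _ _ _ b (zero_mem a)
  rw [zero_mul] at h
  exact eq_neg_of_zero_mem h

theorem neg_mem {a b c : A} (h : a ∈ b +ₘ c) : -a ∈ -b +ₘ -c := by
  have h1 := mul_mem_hadd _ _ _ (-1) h
  simpa only [mul_comm _ (-1 : A), neg_mul', one_mul] using h1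

theorem mem_of_mem_neg {a b c : A} (h : a ∈ b +ₘ -c) : b ∈ a +ₘ c := by
  have h1 := mem_hadd_neg _ _ _ h
  rwa [neg_neg'] at h1

end IsMultiring

/-! ### Ideals, quotients, localizations and residue hyperfields -/

/-- Ideals of a multiring. -/
structure MIdeal (A : Type u) [MultiringStr A] where
  carrier : Set A
  zero_mem : 0 ∈ carrier
  hadd_subset : ∀ a ∈ carrier, ∀ b ∈ carrier, a +ₘ b ⊆ carrier
  mul_mem : ∀ a, ∀ b ∈ carrier, a * b ∈ carrier

namespace MIdeal

variable {A : Type u} [MultiringStr A]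

/-- Prime ideals: proper, and `a * b ∈ I` implies `a ∈ I` or `b ∈ I`. -/
def IsPrime (I : MIdeal A) : Prop :=
  1 ∉ I.carrier ∧ ∀ a b, a * b ∈ I.carrier → a ∈ I.carrier ∨ b ∈ I.carrier

variable [IsMultiring A] (I : MIdeal A)

theorem neg_mem {a : A} (h : a ∈ I.carrier) : -a ∈ I.carrier := by
  have := I.mul_mem (-1) a h
  rwa [IsMultiring.neg_mul', one_mul] at this

/-- `a ∼ b` modulo `I` iff `a - b` meets `I`. -/
def Rel (a b : A) : Prop := ((a +ₘ -b) ∩ I.carrier).Nonempty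

theorem rel_refl (a : A) : I.Rel a a := ⟨0, IsMultiring.zero_mem a, I.zero_mem⟩

theorem rel_symm {a b : A} (h : I.Rel a b) : I.Rel b a := by
  obtain ⟨z, hz, hI⟩ := h
  refine ⟨-z, ?_, I.neg_mem hI⟩
  have := IsMultiring.neg_mem hz
  rwa [IsMultiring.neg_neg', IsMultiring.hadd_comm] at this

theorem rel_iff {a b : A} : I.Rel a b ↔ ∃ i ∈ I.carrier, a ∈ b +ₘ i := by
  constructor
  · rintro ⟨z, hz, hI⟩
    refine ⟨z, hI, ?_⟩
    rw [IsMultiring.hadd_comm]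
    exact IsMultiring.mem_of_mem_neg hz
  · rintro ⟨i, hI, hi⟩
    refine ⟨i, ?_, hI⟩
    rw [IsMultiring.hadd_comm]
    exact IsMultiring.mem_neg_hadd _ _ _ hi

theorem rel_trans {a b c : A} (h : I.Rel a b) (h' : I.Rel b c) : I.Rel a c := by
  obtain ⟨i, hi, hai⟩ := I.rel_iff.1 h
  obtain ⟨j, hj, hbj⟩ := I.rel_iff.1 h'
  obtain ⟨k, hk, hak⟩ := IsMultiring.hadd_assoc _ _ _ _ _ hai hbj
  exact I.rel_iff.2 ⟨k, I.hadd_subset _ hj _ hi hk, hak⟩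

theorem rel_mul_right {a b : A} (c : A) (h : I.Rel a b) : I.Rel (a * c) (b * c) := by
  obtain ⟨z, hz, hI⟩ := h
  refine ⟨z * c, ?_, mul_comm c z ▸ I.mul_mem c z hI⟩
  rw [← IsMultiring.neg_mul']
  exact IsMultiring.mul_mem_hadd _ _ _ _ hz

theorem rel_neg {a b : A} (h : I.Rel a b) : I.Rel (-a) (-b) := by
  obtain ⟨z, hz, hI⟩ := h
  exact ⟨-z, IsMultiring.neg_mem hz, I.neg_mem hI⟩

/-- Congruence modulo `I`. -/
def con : Con A where
  r := I.Rel
  iseqv := ⟨I.rel_refl, I.rel_symm, I.rel_trans⟩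
  mul' {a b c d} h h' := by
    refine I.rel_trans (I.rel_mul_right c h) ?_
    rw [mul_comm b c, mul_comm b d]
    exact I.rel_mul_right b h'

/-- The quotient `A / I`. -/
def Quo : Type u := I.con.Quotient

/-- The projection `A → A / I`. -/
def toQuo (a : A) : I.Quo := (a : I.con.Quotient)

variable {I} in
theorem toQuo_surj (x : I.Quo) : ∃ a, I.toQuo a = x := Quotient.exists_rep x

theorem toQuo_eq {a b : A} : I.toQuo a = I.toQuo b ↔ I.Rel a b := Con.eq I.con

instance : CommMonoid I.Quo := inferInstanceAs (CommMonoid I.con.Quotient)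

theorem toQuo_mul (a b : A) : I.toQuo (a * b) = I.toQuo a * I.toQuo b := rfl

/-- The sum of `A / I` is computed on representatives. -/
instance : MultiringStr I.Quo where
  zero := I.toQuo 0
  neg := Quotient.map' (fun a => -a) (fun _ _ h => I.rel_neg h)
  zero_mul x := by
    obtain ⟨a, rfl⟩ := toQuo_surj x
    exact congrArg I.toQuo (zero_mul a)
  mul_zero x := by
    obtain ⟨a, rfl⟩ := toQuo_surj x
    exact congrArg I.toQuo (mul_zero a)
  hadd x y := {z | ∃ a b c : A, I.toQuo a = z ∧ I.toQuo b = x ∧ I.toQuo c = y ∧ a ∈ b +ₘ c}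

theorem toQuo_neg (a : A) : I.toQuo (-a) = -I.toQuo a := rfl

theorem toQuo_eq_zero {a : A} : I.toQuo a = 0 ↔ a ∈ I.carrier := by
  change I.toQuo a = I.toQuo 0 ↔ _
  rw [toQuo_eq]
  constructor
  · rintro ⟨z, hz, hI⟩
    rw [IsMultiring.neg_zero', IsMultiring.mem_hadd_zero] at hz
    rwa [← hz]
  · intro h
    exact ⟨a, by rw [IsMultiring.neg_zero', IsMultiring.mem_hadd_zero], h⟩

theorem mem_hadd_toQuo {x : I.Quo} {b c : A} (h : x ∈ I.toQuo b +ₘ I.toQuo c) :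
    ∃ a, I.toQuo a = x ∧ a ∈ b +ₘ c := by
  obtain ⟨a, b', c', rfl, hb, hc, habc⟩ := h
  obtain ⟨i, hi, hbi⟩ := I.rel_iff.1 (I.toQuo_eq.1 hb)
  obtain ⟨j, hj, hcj⟩ := I.rel_iff.1 (I.toQuo_eq.1 hc)
  -- `a ∈ b' + c'`, `b' ∈ i + b`, `c' ∈ j + c`
  rw [IsMultiring.hadd_comm] at hbi hcj
  obtain ⟨h, hh, hah⟩ := IsMultiring.hadd_assoc _ _ _ _ _ habc hbi
  rw [IsMultiring.hadd_comm] at hh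
  obtain ⟨k, hk, hhk⟩ := IsMultiring.hadd_assoc _ _ _ _ _ hh hcj
  rw [IsMultiring.hadd_comm] at hk hah
  rw [IsMultiring.hadd_comm] at hhk
  obtain ⟨l, hl, hal⟩ := IsMultiring.hadd_assoc _ _ _ _ _ hah hhk
  exact ⟨k, I.toQuo_eq.2 (I.rel_symm (I.rel_iff.2 ⟨l, I.hadd_subset _ hj _ hi hl, hal⟩)), hk⟩

instance : IsMultiring I.Quo where
  hadd_nonempty x y := by
    obtain ⟨a, rfl⟩ := toQuo_surj x
    obtain ⟨b, rfl⟩ := toQuo_surj y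
    obtain ⟨c, hc⟩ := IsMultiring.hadd_nonempty a b
    exact ⟨I.toQuo c, c, a, b, rfl, rfl, rfl, hc⟩
  mem_neg_hadd := by
    rintro _ _ _ ⟨a, b, c, rfl, rfl, rfl, h⟩
    exact ⟨c, -b, a, rfl, rfl, rfl, IsMultiring.mem_neg_hadd _ _ _ h⟩
  mem_hadd_neg := by
    rintro _ _ _ ⟨a, b, c, rfl, rfl, rfl, h⟩
    exact ⟨b, a, -c, rfl, rfl, rfl, IsMultiring.mem_hadd_neg _ _ _ h⟩
  mem_hadd_zero x y := by
    obtain ⟨b, rfl⟩ := toQuo_surj y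
    constructor
    · intro h
      obtain ⟨a, rfl, ha⟩ := I.mem_hadd_toQuo (c := 0) h
      rw [IsMultiring.mem_hadd_zero] at ha
      rw [ha]
    · rintro rfl
      exact ⟨b, b, 0, rfl, rfl, rfl, (IsMultiring.mem_hadd_zero b b).2 rfl⟩
  hadd_assoc x y z g w hw hg := by
    obtain ⟨a, rfl⟩ := toQuo_surj x
    obtain ⟨b, rfl⟩ := toQuo_surj y
    obtain ⟨c, rfl⟩ := toQuo_surj z
    obtain ⟨g, rfl, hg'⟩ := I.mem_hadd_toQuo hg
    obtain ⟨w, rfl, hw'⟩ := I.mem_hadd_toQuo hw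
    obtain ⟨h, hh, hwh⟩ := IsMultiring.hadd_assoc a b c g w hw' hg'
    exact ⟨I.toQuo h, ⟨h, b, c, rfl, rfl, rfl, hh⟩, ⟨w, a, h, rfl, rfl, rfl, hwh⟩⟩
  hadd_comm x y := by
    ext z
    constructor <;> rintro ⟨a, b, c, ha, hb, hc, h⟩ <;>
      exact ⟨a, c, b, ha, hc, hb, by rwa [IsMultiring.hadd_comm]⟩
  mul_mem_hadd x y z w hx := by
    obtain ⟨a, b, c, rfl, rfl, rfl, h⟩ := hx
    obtain ⟨d, rfl⟩ := toQuo_surj w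
    exact ⟨a * d, b * d, c * d, rfl, rfl, rfl, IsMultiring.mul_mem_hadd _ _ _ d h⟩

end MIdeal

/-- The operations of the localization `S⁻¹A`. Its elements are the fractions `a/s`, with
`a/s = b/t` iff `a t u = b s u` for some `u ∈ S`, its product is `(a/s)(b/t) = ab/st`, the opposite
of `a/s` is `(-a)/s`, and `a/s ∈ b/t + c/u` iff `a t u v ∈ b s u v + c s t v` for some `v ∈ S`. -/
noncomputable instance {A : Type u} [MultiringStr A] [IsMultiring A] (S : Submonoid A) :
    MultiringStr (Localization S) where
  neg x := Localization.liftOn x (fun a s => Localization.mk (-a) s) (by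
    intro a c b d h
    rw [Localization.mk_eq_mk_iff]
    obtain ⟨u, hu⟩ := Localization.r_iff_exists.1 h
    refine Localization.r_iff_exists.2 ⟨u, ?_⟩
    simp only [mul_comm _ (-_ : A), mul_comm (u : A), IsMultiring.neg_mul'] at hu ⊢
    rw [mul_comm a, mul_comm c, hu])
  hadd x y := {z | ∃ (a b c : A) (s t u : S),
    Localization.mk a s = z ∧ Localization.mk b t = x ∧ Localization.mk c u = y ∧
    ∃ v ∈ S, a * t * u * v ∈ (b * s * u * v) +ₘ (c * s * t * v)}

/-- The prime spectrum. -/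
def MSpec (A : Type u) [MultiringStr A] : Type u := {I : MIdeal A // I.IsPrime}

namespace MSpec

variable {A : Type u} [MultiringStr A]

/-- The basic open set `D(a)`. -/
def D (a : A) : Set (MSpec A) := {p | a ∉ p.1.carrier}

/-- The constructible topology on the prime spectrum: the coarsest topology in which all the sets
`D(a)` are open and closed. -/
instance constructible : TopologicalSpace (MSpec A) :=
  TopologicalSpace.generateFrom ({U | ∃ a : A, U = D a} ∪ {U | ∃ a : A, U = (D a)ᶜ})

theorem one_mem_D (p : MSpec A) : p ∈ D (1 : A) := p.2.1

theorem mul_mem_D {p : MSpec A} {a b : A} (ha : p ∈ D a) (hb : p ∈ D b) : p ∈ D (a * b) :=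
  fun h => (p.2.2 a b h).elim ha hb

/-- The preimage of a prime ideal under a morphism. -/
def comap {B : Type v} [MultiringStr B] (f : MultiringHom A B) (p : MSpec B) : MSpec A where
  val :=
    { carrier := {a | f a ∈ p.1.carrier}
      zero_mem := by
        change f 0 ∈ p.1.carrier
        rw [f.map_zero]
        exact p.1.zero_mem
      hadd_subset := fun a ha b hb c hc => p.1.hadd_subset _ ha _ hb (f.map_hadd _ _ _ hc)
      mul_mem := fun a b hb => by
        change f (a * b) ∈ p.1.carrier
        rw [f.map_mul]
        exact p.1.mul_mem _ _ hb }
  property := by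
    refine ⟨fun h => p.2.1 ?_, fun a b h => p.2.2 _ _ ?_⟩
    · rw [← f.map_one]
      exact h
    · rw [← f.map_mul]
      exact h

theorem continuous_comap {B : Type v} [MultiringStr B] (f : MultiringHom A B) : Continuous (comap f) := by
  refine continuous_generateFrom_iff.2 ?_
  rintro _ (⟨a, rfl⟩ | ⟨a, rfl⟩)
  · exact TopologicalSpace.isOpen_generateFrom_of_mem (Or.inl ⟨f a, rfl⟩)
  · exact TopologicalSpace.isOpen_generateFrom_of_mem (Or.inr ⟨f a, rfl⟩)

variable [IsMultiring A]

/-- The set of nonzero elements of `A / p`. -/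
def nonzero (p : MSpec A) : Submonoid p.1.Quo where
  carrier := {x | x ≠ 0}
  one_mem' h := p.2.1 (p.1.toQuo_eq_zero.1 h)
  mul_mem' {x y} hx hy h := by
    obtain ⟨a, rfl⟩ := MIdeal.toQuo_surj x
    obtain ⟨b, rfl⟩ := MIdeal.toQuo_surj y
    rcases p.2.2 a b (p.1.toQuo_eq_zero.1 h) with h | h
    · exact hx (p.1.toQuo_eq_zero.2 h)
    · exact hy (p.1.toQuo_eq_zero.2 h)

/-- The residue hyperfield `K_A(p)`, the fraction field of `A / p`. -/
abbrev K (p : MSpec A) : Type u := Localization p.nonzero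

/-- The fraction `x/y ∈ K_A(p)` for `p ∈ D(y)`. -/
def kfrac (p : MSpec A) (x y : A) (hy : p ∈ D y) : p.K :=
  Localization.mk (p.1.toQuo x) ⟨p.1.toQuo y, fun h => hy (p.1.toQuo_eq_zero.1 h)⟩


theorem kfrac_mul (p : MSpec A) (x y x' y' : A) (hy : p ∈ D y) (hy' : p ∈ D y')
    (h : p ∈ D (y * y')) :
    p.kfrac x y hy * p.kfrac x' y' hy' = p.kfrac (x * x') (y * y') h :=
  Localization.mk_mul _ _ _ _

theorem kfrac_neg (p : MSpec A) (x y : A) (hy : p ∈ D y) :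
    -p.kfrac x y hy = p.kfrac (-x) y hy := rfl

theorem kfrac_one (p : MSpec A) : p.kfrac 1 1 p.one_mem_D = 1 := Localization.mk_one

theorem kfrac_zero (p : MSpec A) : p.kfrac 0 1 p.one_mem_D = 0 := Localization.mk_zero _

variable {B : Type v} [MultiringStr B] [IsMultiring B]

/-- The map `A / f⁻¹(p) → B / p` induced by `f`. -/
def quoMap (f : MultiringHom A B) (p : MSpec B) : (comap f p).1.Quo →* p.1.Quo where
  toFun := Quotient.map' f (by
    rintro a b ⟨z, hz, hI⟩
    refine ⟨f z, ?_, hI⟩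
    rw [← f.map_neg]
    exact f.map_hadd _ _ _ hz)
  map_one' := congrArg p.1.toQuo f.map_one
  map_mul' x y := by
    obtain ⟨a, rfl⟩ := MIdeal.toQuo_surj x
    obtain ⟨b, rfl⟩ := MIdeal.toQuo_surj y
    exact congrArg p.1.toQuo (f.map_mul a b)

theorem quoMap_mem (f : MultiringHom A B) (p : MSpec B) (s : (comap f p).nonzero) :
    quoMap f p s ∈ p.nonzero := by
  obtain ⟨s, hs⟩ := s
  obtain ⟨a, rfl⟩ := MIdeal.toQuo_surj s
  exact fun h => hs ((MIdeal.toQuo_eq_zero _).2 (p.1.toQuo_eq_zero.1 h))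

/-- The map `K_A(f⁻¹(p)) → K_B(p)`, `x/y ↦ f(x)/f(y)`, induced by `f`. -/
noncomputable def kMap (f : MultiringHom A B) (p : MSpec B) : (comap f p).K → p.K :=
  (Localization.monoidOf (comap f p).nonzero).map (quoMap_mem f p)
    (Localization.monoidOf p.nonzero)

theorem kMap_kfrac (f : MultiringHom A B) (p : MSpec B) (x y : A) (hy : comap f p ∈ D y) :
    kMap f p ((comap f p).kfrac x y hy) = p.kfrac (f x) (f y) hy := by
  unfold kMap kfrac
  rw [Localization.mk_eq_monoidOf_mk'_apply, Submonoid.LocalizationMap.map_mk',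
    Localization.mk_eq_monoidOf_mk'_apply]
  rfl

end MSpec

/-! ### The von Neumann hull -/

/-- The von Neumann hull `V(A)`: families `s(p) ∈ K_A(p)`, for `p` in the prime spectrum, such that
every point has a clopen neighbourhood `U` in the constructible topology on which `s` is given by
one fraction `x/y` with `U ⊆ D(y)`. -/
@[ext]
structure VNHull (A : Type u) [MultiringStr A] [IsMultiring A] : Type u where
  val : ∀ p : MSpec A, p.K
  constructible : ∀ p : MSpec A, ∃ U : Set (MSpec A), IsClopen U ∧ p ∈ U ∧
    ∃ x y : A, ∀ q ∈ U, ∃ hy : q ∈ MSpec.D y, val q = q.kfrac x y hy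

namespace VNHull

variable {A : Type u} [MultiringStr A] [IsMultiring A]

/-- The natural map `v_A : A → V(A)`, `a ↦ (p ↦ a/1)`. -/
def of (a : A) : VNHull A where
  val p := p.kfrac a 1 p.one_mem_D
  constructible _ := ⟨Set.univ, isClopen_univ, trivial, a, 1, fun q _ => ⟨q.one_mem_D, rfl⟩⟩

/-- All operations of `V(A)`, the multivalued sum included, are pointwise. -/
noncomputable instance : MultiringStr (VNHull A) where
  mul s t :=
    { val := fun p => s.val p * t.val p
      constructible := fun p => by
        obtain ⟨U, hU, hp, x, y, h⟩ := s.constructible p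
        obtain ⟨U', hU', hp', x', y', h'⟩ := t.constructible p
        refine ⟨U ∩ U', hU.inter hU', ⟨hp, hp'⟩, x * x', y * y', fun q hq => ?_⟩
        obtain ⟨hy, h⟩ := h q hq.1
        obtain ⟨hy', h'⟩ := h' q hq.2
        exact ⟨MSpec.mul_mem_D hy hy', by rw [h, h', MSpec.kfrac_mul]⟩ }
  one :=
    { val := fun _ => 1
      constructible := fun p => ⟨Set.univ, isClopen_univ, trivial, 1, 1,
        fun q _ => ⟨q.one_mem_D, q.kfrac_one.symm⟩⟩ }
  zero :=
    { val := fun _ => 0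
      constructible := fun p => ⟨Set.univ, isClopen_univ, trivial, 0, 1,
        fun q _ => ⟨q.one_mem_D, q.kfrac_zero.symm⟩⟩ }
  neg s :=
    { val := fun p => -s.val p
      constructible := fun p => by
        obtain ⟨U, hU, hp, x, y, h⟩ := s.constructible p
        refine ⟨U, hU, hp, -x, y, fun q hq => ?_⟩
        obtain ⟨hy, h⟩ := h q hq
        exact ⟨hy, by rw [h, MSpec.kfrac_neg]⟩ }
  mul_assoc _ _ _ := VNHull.ext (funext fun _ => mul_assoc _ _ _)
  mul_comm _ _ := VNHull.ext (funext fun _ => mul_comm _ _)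
  one_mul _ := VNHull.ext (funext fun _ => one_mul _)
  mul_one _ := VNHull.ext (funext fun _ => mul_one _)
  zero_mul _ := VNHull.ext (funext fun _ => zero_mul _)
  mul_zero _ := VNHull.ext (funext fun _ => mul_zero _)
  hadd s t := {r | ∀ p : MSpec A, r.val p ∈ s.val p +ₘ t.val p}

variable {B : Type v} [MultiringStr B] [IsMultiring B]

/-- The map `V(f) : V(A) → V(B)` induced by a morphism `f : A → B`: the value of `V(f)(s)` at `p` is
the image of `s(f⁻¹(p))` under `K_A(f⁻¹(p)) → K_B(p)`. -/
noncomputable def map (f : MultiringHom A B) (s : VNHull A) : VNHull B where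
  val p := MSpec.kMap f p (s.val (MSpec.comap f p))
  constructible p := by
    obtain ⟨U, hU, hp, x, y, h⟩ := s.constructible (MSpec.comap f p)
    refine ⟨MSpec.comap f ⁻¹' U, hU.preimage (MSpec.continuous_comap f), hp, f x, f y,
      fun q hq => ?_⟩
    obtain ⟨hy, h⟩ := h _ hq
    exact ⟨hy, by rw [h, MSpec.kMap_kfrac]⟩

/-- `V(f) ∘ v_A = v_B ∘ f`. -/
theorem map_of (f : MultiringHom A B) (a : A) : map f (of a) = of (f a) := by
  refine VNHull.ext (funext fun p => ?_)
  change MSpec.kMap f p (MSpec.kfrac _ a 1 (MSpec.one_mem_D _)) = _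
  rw [MSpec.kMap_kfrac]
  change _ = p.kfrac (f a) 1 p.one_mem_D
  congr 1
  exact f.map_one

end VNHull

/-! ### Sums in multirings -/

/-! The theorem rests on two facts: sums in `Q(A)` can be tested order by order
(`RRQuot.mem_hadd_iff`), and `V(A)` has the same orders as `A` (`RealSpec.hullOrder_restrict`).

The first comes from a Positivstellensatz for multirings (`IsPreordering.exists_order`), proved with
Zorn's lemma. If `p` or `q` is positive wherever `a` does not vanish, it yields an algebraic
certificate. From it one builds a nowhere negative combination of `p` and `q` with square
coefficients that is positive where `p` is. Sign conditions at all orders can thus be realised by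
actual sums of elements with prescribed signs (`exists_sameSign_mem_hadd`,
`exists_representatives`). This gives the description of sums in `Q(A)` and its associativity.

For the second, the constructible topology is compact and relations between fractions spread from a
point to a clopen neighbourhood. Hence elements of `V(A)` can be glued (`VNHull.exists_of_local`),
which makes `V(A)` a multiring. An order of `A` extends to `V(A)` by taking the sign of the value at
its support; every order of `V(A)` arises so, since it takes the value 1 on indicators of small
clopen neighbourhoods of that support.

Finally `V(π)` is surjective, identifies `s` and `t` exactly when they have the same sign at every
order of `V(A)` (`VNHull.map_proj_eq_iff`), and every order of `V(A)` factors through it. So it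
induces a bijection from `Q(V(A))`, and the inverse preserves sums because sums in `Q(V(A))` are
tested on orders. Uniqueness follows from surjectivity of the projection onto `Q(V(A))`. -/

theorem SignType.mem_hadd_iff {a b c : SignType} : a ∈ b +ₘ c ↔
    if b = 0 then a = c else if c = 0 then a = b else if b = c then a = b else True := by
  change a ∈ (if b = 0 then {c} else if c = 0 then {b} else if b = c then {b} else Set.univ :
    Set SignType) ↔ _
  split_ifs <;> simp

/-- Arguments at a single order become finite checks: the values of the order are generalized to
arbitrary signs and `decide` runs through all cases. -/
instance SignType.decidableMemHadd (a b c : SignType) : Decidable (a ∈ b +ₘ c) :=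
  decidable_of_iff _ SignType.mem_hadd_iff.symm

namespace IsMultiring

variable {A : Type u} [MultiringStr A]

theorem mem_hadd_congr {a a' b b' c c' : A} (ha : a = a') (hb : b = b') (hc : c = c')
    (h : a ∈ b +ₘ c) : a' ∈ b' +ₘ c' := by
  subst ha hb hc
  exact h

variable [IsMultiring A]

instance hasDistribNeg : HasDistribNeg A where
  neg_neg := neg_neg'
  neg_mul := neg_mul'
  mul_neg a b := by rw [mul_comm, neg_mul', mul_comm]

theorem mem_comm {a b c : A} (h : a ∈ b +ₘ c) : a ∈ c +ₘ b := by rwa [hadd_comm]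

theorem mem_zero_hadd {a b : A} : a ∈ (0 : A) +ₘ b ↔ a = b := by
  rw [hadd_comm, mem_hadd_zero]

theorem mem_add_zero (a : A) : a ∈ a +ₘ (0 : A) := (mem_hadd_zero a a).2 rfl

theorem mul_mem_hadd_left {a b c : A} (d : A) (h : a ∈ b +ₘ c) : d * a ∈ (d * b) +ₘ (d * c) := by
  simpa only [mul_comm d] using mul_mem_hadd a b c d h

/-- `a ∈ b + c` implies `b ∈ a - c`. -/
theorem mem_sub_right {a b c : A} (h : a ∈ b +ₘ c) : b ∈ a +ₘ -c := mem_hadd_neg _ _ _ h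

/-- `a ∈ b + c` implies `c ∈ a - b`. -/
theorem mem_sub_left {a b c : A} (h : a ∈ b +ₘ c) : c ∈ a +ₘ -b := mem_sub_right (mem_comm h)

theorem hadd_assoc_symm {a b c h x : A} (hx : x ∈ a +ₘ h) (hh : h ∈ b +ₘ c) :
    ∃ g ∈ a +ₘ b, x ∈ g +ₘ c := by
  obtain ⟨g, hg, hxg⟩ := hadd_assoc c b a h x (mem_comm hx) (mem_comm hh)
  exact ⟨g, mem_comm hg, mem_comm hxg⟩

theorem hadd_hadd_hadd_comm {a b c d k l x : A} (hx : x ∈ k +ₘ l) (hk : k ∈ a +ₘ b)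
    (hl : l ∈ c +ₘ d) : ∃ y ∈ a +ₘ c, ∃ z ∈ b +ₘ d, x ∈ y +ₘ z := by
  obtain ⟨h, hh, hxh⟩ := hadd_assoc _ _ _ _ _ hx hk
  obtain ⟨g, hg, hhg⟩ := hadd_assoc_symm hh hl
  obtain ⟨z, hz, hhz⟩ := hadd_assoc _ _ _ _ _ hhg (mem_comm hg)
  obtain ⟨y, hy, hxy⟩ := hadd_assoc_symm hxh hhz
  exact ⟨y, hy, z, hz, hxy⟩

end IsMultiring

open IsMultiring

theorem MultiringHom.ext {A : Type u} {B : Type v} [MultiringStr A] [MultiringStr B]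
    {f g : MultiringHom A B} (h : ∀ a, f a = g a) : f = g := by
  obtain ⟨f, _⟩ := f
  obtain ⟨g, _⟩ := g
  congr
  exact funext h

/-- Composition of morphisms. -/
def MultiringHom.comp {A B C : Type*} [MultiringStr A] [MultiringStr B] [MultiringStr C]
    (g : MultiringHom B C) (f : MultiringHom A B) : MultiringHom A C where
  toFun a := g (f a)
  map_hadd _ _ _ h := g.map_hadd _ _ _ (f.map_hadd _ _ _ h)
  map_mul a b := by rw [f.map_mul, g.map_mul]
  map_zero := by rw [f.map_zero, g.map_zero]
  map_one := by rw [f.map_one, g.map_one]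
  map_neg a := by rw [f.map_neg, g.map_neg]

/-- `IsSum S x`: the element `x` belongs to a finite sum of elements of `S`. -/
inductive IsSum {A : Type u} [MultiringStr A] (S : Set A) : A → Prop
  | zero : IsSum S 0
  | cons {x y z : A} : x ∈ S → IsSum S z → y ∈ x +ₘ z → IsSum S y

namespace IsSum

variable {A : Type u} [MultiringStr A] {S S' S'' : Set A} {x y z : A}

theorem mem_of_closed {T : Set A} (h0 : 0 ∈ T) (hadd : ∀ a ∈ T, ∀ b ∈ T, a +ₘ b ⊆ T)
    (h : ∀ s ∈ S, s ∈ T) (hx : IsSum S x) : x ∈ T := by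
  induction hx with
  | zero => exact h0
  | cons hs _ hx ih => exact hadd _ (h _ hs) _ ih hx

variable [IsMultiring A]

theorem of_mem (h : x ∈ S) : IsSum S x := cons h zero (mem_add_zero x)

theorem add (hx : IsSum S x) (hy : IsSum S y) (hz : z ∈ x +ₘ y) : IsSum S z := by
  induction hx generalizing z with
  | zero => rwa [mem_zero_hadd.1 hz]
  | cons hs _ hx ih =>
    obtain ⟨h, hh, hzh⟩ := hadd_assoc _ _ _ _ _ hz hx
    exact cons hs (ih hh) hzh

theorem mul_right (y : A) (h : ∀ s ∈ S, IsSum S' (s * y)) (hx : IsSum S x) :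
    IsSum S' (x * y) := by
  induction hx with
  | zero => rw [zero_mul]; exact zero
  | cons hs _ hx ih => exact (h _ hs).add ih (mul_mem_hadd _ _ _ y hx)

theorem mul (h : ∀ s ∈ S, ∀ t ∈ S', IsSum S'' (s * t)) (hx : IsSum S x) (hy : IsSum S' y) :
    IsSum S'' (x * y) :=
  hx.mul_right y fun s hs => by
    rw [mul_comm]
    exact hy.mul_right s fun t ht => by rw [mul_comm]; exact h s hs t ht

theorem bind (h : ∀ s ∈ S, IsSum S' s) (hx : IsSum S x) : IsSum S' x := by
  have := hx.mul_right (S' := S') 1 (by simpa using h)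
  rwa [mul_one] at this

theorem neg (h : ∀ s ∈ S, IsSum S' (-s)) (hx : IsSum S x) : IsSum S' (-x) := by
  have := hx.mul_right (S' := S') (-1) (by simpa using h)
  rwa [mul_neg, mul_one] at this

/-- Associativity and commutativity let the summands be sorted by the set they come from. -/
theorem split (h : IsSum (S ∪ S') x) : ∃ m n, IsSum S m ∧ IsSum S' n ∧ x ∈ m +ₘ n := by
  induction h with
  | zero => exact ⟨0, 0, zero, zero, mem_add_zero 0⟩
  | cons hs _ hx ih =>
    obtain ⟨m, n, hm, hn, hmn⟩ := ih
    rcases hs with hs | hs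
    · obtain ⟨g, hg, hxg⟩ := hadd_assoc_symm hx hmn
      exact ⟨g, n, cons hs hm hg, hn, hxg⟩
    · obtain ⟨g, hg, hxg⟩ := hadd_assoc_symm hx (mem_comm hmn)
      exact ⟨m, g, hm, cons hs hn hg, mem_comm hxg⟩

end IsSum

/-! ### Preorderings and the existence of orders -/

/-- Preorderings: sets closed under sums and products that contain all squares. -/
structure IsPreordering {A : Type u} [MultiringStr A] (T : Set A) : Prop where
  add : ∀ a ∈ T, ∀ b ∈ T, a +ₘ b ⊆ T
  mul : ∀ a ∈ T, ∀ b ∈ T, a * b ∈ T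
  sq : ∀ a, a * a ∈ T

namespace IsPreordering

variable {A : Type u} [MultiringStr A] {T : Set A}

theorem zero_mem (hT : IsPreordering T) : (0 : A) ∈ T := by simpa using hT.sq 0

theorem one_mem (hT : IsPreordering T) : (1 : A) ∈ T := by simpa using hT.sq 1

/-- The preordering generated by `T` and `a`. -/
def adjoin (T : Set A) (a : A) : Set A :=
  {z | ∃ t ∈ T, ∃ w, IsSum {y | ∃ t ∈ T, y = t * a} w ∧ z ∈ t +ₘ w}

variable [IsMultiring A]

theorem subset_adjoin (a : A) : T ⊆ adjoin T a := fun t ht =>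
  ⟨t, ht, 0, .zero, mem_add_zero t⟩

theorem mem_adjoin (hT : IsPreordering T) (a : A) : a ∈ adjoin T a :=
  ⟨0, hT.zero_mem, a, .of_mem ⟨1, hT.one_mem, (one_mul a).symm⟩, mem_comm (mem_add_zero a)⟩

theorem isPreordering_adjoin (hT : IsPreordering T) (a : A) : IsPreordering (adjoin T a) where
  add := by
    rintro x ⟨t, ht, w, hw, hx⟩ y ⟨t', ht', w', hw', hy⟩ z hz
    obtain ⟨k, hk, l, hl, hzl⟩ := hadd_hadd_hadd_comm hz hx hy
    exact ⟨k, hT.add _ ht _ ht' hk, l, hw.add hw' hl, hzl⟩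
  mul := by
    rintro x ⟨t, ht, w, hw, hx⟩ y ⟨t', ht', w', hw', hy⟩
    obtain ⟨k, hk, l, hl, hzl⟩ := hadd_hadd_hadd_comm (mul_mem_hadd _ _ _ y hx)
      (mul_mem_hadd_left t hy) (mem_comm (mul_mem_hadd_left w hy))
    refine ⟨k, hT.add _ (hT.mul _ ht _ ht') _ ?_ hk, l, .add ?_ ?_ hl, hzl⟩
    · refine (IsSum.mul (S'' := T) ?_ hw hw').mem_of_closed hT.zero_mem hT.add fun _ h => h
      rintro _ ⟨s, hs, rfl⟩ _ ⟨s', hs', rfl⟩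
      rw [mul_mul_mul_comm]
      exact .of_mem (hT.mul _ (hT.mul _ hs _ hs') _ (hT.sq a))
    · rw [mul_comm]
      refine hw'.mul_right t ?_
      rintro _ ⟨s, hs, rfl⟩
      exact .of_mem ⟨_, hT.mul _ hs _ ht, by ac_rfl⟩
    · refine hw.mul_right t' ?_
      rintro _ ⟨s, hs, rfl⟩
      exact .of_mem ⟨_, hT.mul _ hs _ ht', by ac_rfl⟩
  sq x := subset_adjoin a (hT.sq x)

/-- A total preordering with prime support defines an order. -/
theorem exists_order_of_total (hT : IsPreordering T) (h1 : (-1 : A) ∉ T)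
    (tot : ∀ a, a ∈ T ∨ -a ∈ T) (prime : ∀ a b, a ∉ T → b ∉ T → -(a * b) ∉ T) :
    ∃ σ : RealSpec A, (∀ t ∈ T, 0 ≤ σ t) ∧ ∀ a, -a ∉ T → σ a ≠ 0 := by
  classical
  let s : A → SignType := fun a => if a ∈ T then (if -a ∈ T then 0 else 1) else -1
  have sgn : ∀ a, (s a = 0 ∧ a ∈ T ∧ -a ∈ T) ∨ (s a = 1 ∧ a ∈ T ∧ -a ∉ T) ∨
      (s a = -1 ∧ a ∉ T ∧ -a ∈ T) := by
    intro a
    have := tot a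
    simp only [s]
    by_cases h : a ∈ T <;> by_cases h' : -a ∈ T <;> simp_all
  have zer : ∀ a, a ∈ T → -a ∈ T → s a = 0 := fun a h h' => by simp [s, h, h']
  have pos : ∀ a, -a ∉ T → s a = 1 := fun a h' => by
    simp [s, (tot a).resolve_right h', h']
  have neg : ∀ a, a ∉ T → s a = -1 := fun a h => by simp [s, h]
  have mulneg : ∀ a b, a ∈ T → -b ∈ T → -(a * b) ∈ T := fun a b ha hb => by
    rw [← mul_neg]
    exact hT.mul _ ha _ hb
  have mulneg' : ∀ a b, -a ∈ T → -b ∈ T → a * b ∈ T := fun a b ha hb => by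
    rw [← neg_mul_neg]
    exact hT.mul _ ha _ hb
  have zmul : ∀ a b, a ∈ T → -a ∈ T → s (a * b) = 0 := by
    intro a b h h'
    rcases tot b with hb | hb
    · refine zer _ (hT.mul _ h _ hb) ?_
      rw [mul_comm]
      exact mulneg _ _ hb h'
    · exact zer _ (mulneg' _ _ h' hb) (mulneg _ _ h hb)
  -- Adding an element of the support `T ∩ -T` does not change the sign.
  have congr : ∀ a b c, a ∈ b +ₘ c → b ∈ T → -b ∈ T → s a = s c := by
    intro a b c h hb hb'
    have h1 : a ∈ T ↔ c ∈ T :=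
      ⟨fun ha => hT.add _ ha _ hb' (mem_sub_left h), fun hc => hT.add _ hb _ hc h⟩
    have h2 : -a ∈ T ↔ -c ∈ T := by
      refine ⟨fun ha => hT.add _ ha _ hb ?_, fun hc => hT.add _ hb' _ hc (neg_mem h)⟩
      simpa using neg_mem (mem_sub_left h)
    simp only [s, h1, h2]
  refine ⟨⟨s, ?_, ?_, ?_, ?_, ?_⟩, ?_, ?_⟩
  · intro a b c h
    rw [SignType.mem_hadd_iff]
    rcases sgn b with ⟨hb, hb1, hb2⟩ | ⟨hb, hb1, hb2⟩ | ⟨hb, hb1, hb2⟩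
    · simp [hb, congr a b c h hb1 hb2]
    · rcases sgn c with ⟨hc, hc1, hc2⟩ | ⟨hc, hc1, hc2⟩ | ⟨hc, hc1, hc2⟩
      · simp [hc, congr a c b (mem_comm h) hc1 hc2]
      · have : s a = 1 := pos a fun ha => hb2 <| hT.add _ ha _ hc1 <| by
          simpa using neg_mem (mem_sub_right h)
        simp [hb, hc, this]
      · simp [hb, hc]
    · rcases sgn c with ⟨hc, hc1, hc2⟩ | ⟨hc, hc1, hc2⟩ | ⟨hc, hc1, hc2⟩
      · simp [hc, congr a c b (mem_comm h) hc1 hc2]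
      · simp [hb, hc]
      · have : s a = -1 := neg a fun ha => hb1 <| hT.add _ ha _ hc2 (mem_sub_right h)
        simp [hb, hc, this]
  · intro a b
    rcases sgn a with ⟨ha, ha1, ha2⟩ | ⟨ha, ha1, ha2⟩ | ⟨ha, ha1, ha2⟩
    · rw [zmul a b ha1 ha2, ha, zero_mul]
    all_goals rcases sgn b with ⟨hb, hb1, hb2⟩ | ⟨hb, hb1, hb2⟩ | ⟨hb, hb1, hb2⟩
    · rw [mul_comm, zmul b a hb1 hb2, hb, mul_zero]
    · rw [ha, hb, pos]
      · rfl
      · simpa using prime _ _ ha2 hb2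
    · rw [ha, hb, neg]
      · rfl
      · simpa using prime _ _ ha2 hb1
    · rw [mul_comm, zmul b a hb1 hb2, hb, mul_zero]
    · rw [ha, hb, neg]
      · rfl
      · simpa using prime _ _ ha1 hb2
    · rw [ha, hb, pos]
      · rfl
      · exact prime _ _ ha1 hb1
  · exact zer 0 hT.zero_mem (by rw [neg_zero']; exact hT.zero_mem)
  · exact pos 1 h1
  · intro a
    change s (-a) = -s a
    rcases sgn a with ⟨ha, ha1, ha2⟩ | ⟨ha, ha1, ha2⟩ | ⟨ha, ha1, ha2⟩
    · rw [ha, zer _ ha2 (by rwa [neg_neg])]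
      rfl
    · rw [ha, neg _ ha2]
    · rw [ha, pos _ (by rwa [neg_neg])]
      rfl
  · intro t ht
    change 0 ≤ s t
    rcases sgn t with ⟨h, -⟩ | ⟨h, -⟩ | ⟨h, h', -⟩
    · rw [h]
    · rw [h]
      decide
    · exact absurd ht h'
  · intro a ha
    change s a ≠ 0
    rw [pos a ha]
    decide

/-- Positivstellensatz: a preordering that avoids the opposites of a multiplicative set of positive
elements is contained in the positive cone of an order at which this set does not vanish. -/
theorem exists_order (hT : IsPreordering T) (S : Submonoid A) (hS : (S : Set A) ⊆ T)
    (hST : ∀ s ∈ S, -s ∉ T) :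
    ∃ σ : RealSpec A, (∀ t ∈ T, 0 ≤ σ t) ∧ ∀ s ∈ S, σ s ≠ 0 := by
  obtain ⟨P, hTP, ⟨⟨hP, hSP⟩, hmax⟩⟩ := zorn_subset_nonempty
    {P : Set A | IsPreordering P ∧ ∀ s ∈ S, -s ∉ P} (by
      intro c hc hchain hne
      refine ⟨⋃₀ c, ⟨⟨?_, ?_, ?_⟩, ?_⟩, fun _ => Set.subset_sUnion_of_mem⟩
      · rintro a ⟨U, hU, ha⟩ b ⟨V, hV, hb⟩
        rcases hchain.total hU hV with h | h
        · exact ((hc hV).1.add _ (h ha) _ hb).trans (Set.subset_sUnion_of_mem hV)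
        · exact ((hc hU).1.add _ ha _ (h hb)).trans (Set.subset_sUnion_of_mem hU)
      · rintro a ⟨U, hU, ha⟩ b ⟨V, hV, hb⟩
        rcases hchain.total hU hV with h | h
        · exact ⟨V, hV, (hc hV).1.mul _ (h ha) _ hb⟩
        · exact ⟨U, hU, (hc hU).1.mul _ ha _ (h hb)⟩
      · intro a
        obtain ⟨U, hU⟩ := hne
        exact ⟨U, hU, (hc hU).1.sq a⟩
      · rintro s hs ⟨U, hU, h⟩
        exact (hc hU).2 s hs h) T ⟨hT, hST⟩
  have hsub : ∀ s ∈ S, s ∈ P := fun s hs => hTP (hS hs)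
  -- By maximality, adjoining `a` to `P` brings in some `-s ∈ t + w`; this is that relation with its
  -- terms moved.
  have key : ∀ a, a ∉ P → ∃ s ∈ S, ∃ t ∈ P, ∃ w, IsSum {y | ∃ t ∈ P, y = t * a} w ∧
      -w ∈ s +ₘ t := by
    intro a ha
    by_contra! hcon
    refine ha (hmax (y := adjoin P a) ⟨isPreordering_adjoin hP a, ?_⟩ (subset_adjoin a)
      (mem_adjoin hP a))
    rintro s hs ⟨t, ht, w, hw, h⟩
    refine hcon s hs t ht w hw ?_
    simpa using neg_mem (mem_sub_left h)
  have prime : ∀ a b, a ∉ P → b ∉ P → -(a * b) ∉ P := by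
    intro a b ha hb hab
    obtain ⟨s, hs, t, ht, w, hw, h⟩ := key a ha
    obtain ⟨s', hs', t', ht', w', hw', h'⟩ := key b hb
    -- Multiplying the two relations gives `w * w' ∈ s * s' + x` with `x ∈ P`. If `-(a * b)` were in
    -- `P`, so would be `-(w * w')`, and hence `-(s * s') ∈ x - w * w'`, which is excluded.
    obtain ⟨x, hx, hx'⟩ := hadd_assoc _ _ _ _ _ (mul_mem_hadd _ _ _ (-w') h)
      (mul_mem_hadd_left s h')
    have hxP : x ∈ P := hP.add _ (hP.mul _ (hsub _ hs) _ ht') _ (hP.mul _ ht _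
      (hP.add _ (hsub _ hs') _ ht' h')) hx
    have hww : -(w * w') ∈ P := by
      refine (IsSum.neg (S' := P) ?_ (IsSum.mul (S'' := -P) ?_ hw hw')).mem_of_closed
        hP.zero_mem hP.add fun _ h => h
      · exact fun z hz => .of_mem hz
      · rintro _ ⟨r, hr, rfl⟩ _ ⟨r', hr', rfl⟩
        refine .of_mem ?_
        rw [Set.mem_neg, mul_mul_mul_comm, ← mul_neg]
        exact hP.mul _ (hP.mul _ hr _ hr') _ hab
    rw [neg_mul_neg] at hx'
    refine hSP (s * s') (S.mul_mem hs hs') (hP.add _ hxP _ hww ?_)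
    exact mem_comm (by simpa using neg_mem (mem_sub_right hx'))
  have h1 : (-1 : A) ∉ P := hSP 1 S.one_mem
  obtain ⟨σ, hσ, hσ'⟩ := exists_order_of_total hP h1 (fun a => by
    by_contra! h
    refine prime a (-a) h.1 h.2 ?_
    rw [mul_neg, neg_neg]
    exact hP.sq a) prime
  exact ⟨σ, fun t ht => hσ t (hTP ht), fun s hs => hσ' s (hSP s hs)⟩

end IsPreordering

/-! ### Sums of multiples by squares -/

theorem SignType.nonneg_of_mem_hadd {x y z : SignType} (h : x ∈ y +ₘ z) (hy : 0 ≤ y)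
    (hz : 0 ≤ z) : 0 ≤ x := by
  revert x y z; decide

theorem SignType.pos_of_mem_hadd {x y z : SignType} (h : x ∈ y +ₘ z) (hy : 0 < y)
    (hz : 0 ≤ z) : 0 < x := by
  revert x y z; decide

theorem SignType.mul_pos' {x y : SignType} (hx : 0 < x) (hy : 0 < y) : 0 < x * y := by
  revert x y; decide

/-- The multiples of `b` by squares. -/
def sqMul {A : Type u} [MultiringStr A] (b : A) : Set A := {y | ∃ x, y = x * x * b}

/-- `SqSum b z`: the element `z` belongs to a finite sum of multiples of `b` by squares. -/
def SqSum {A : Type u} [MultiringStr A] (b : A) : A → Prop := IsSum (sqMul b)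

namespace SqSum

variable {A : Type u} [MultiringStr A] {a b c x y z : A}

/-- Each square multiple of `b` has sign 0 or that of `b`, and adding such signs creates no other.
-/
theorem sign_eq (σ : RealSpec A) (hx : SqSum b x) : σ x = 0 ∨ σ x = σ b := by
  induction hx with
  | zero => exact .inl σ.map_zero
  | cons hs _ hx ih =>
    obtain ⟨s, rfl⟩ := hs
    have h := σ.map_hadd _ _ _ hx
    rw [σ.map_mul, σ.map_mul] at h
    revert h ih
    generalize σ s = s
    generalize σ b = b
    generalize σ _ = x
    generalize σ _ = y
    revert s b x y
    decide

theorem nonneg (σ : RealSpec A) (hx : SqSum 1 x) : 0 ≤ σ x := by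
  rcases hx.sign_eq σ with h | h
  · rw [h]
  · rw [h, σ.map_one]
    decide

variable [IsMultiring A]

theorem self (b : A) : SqSum b b := .of_mem ⟨1, by simp⟩

theorem mul_self (x : A) : SqSum 1 (x * x) := .of_mem ⟨x, by simp⟩

theorem one : SqSum (1 : A) 1 := self 1

theorem mul (hx : SqSum b x) (hy : SqSum c y) : SqSum (b * c) (x * y) := by
  refine IsSum.mul ?_ hx hy
  rintro _ ⟨s, rfl⟩ _ ⟨t, rfl⟩
  exact .of_mem ⟨s * t, by ac_rfl⟩

theorem bind (h : SqSum b c) (hx : SqSum c x) : SqSum b x := by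
  refine IsSum.bind ?_ hx
  rintro _ ⟨s, rfl⟩
  have := (mul_self s).mul h
  rwa [one_mul] at this

theorem neg (hx : SqSum b x) : SqSum (-b) (-x) := by
  refine IsSum.neg ?_ hx
  rintro _ ⟨s, rfl⟩
  exact .of_mem ⟨s, by simp⟩

theorem neg' (hx : SqSum (-b) x) : SqSum b (-x) := by simpa using hx.neg

theorem add (hx : SqSum b x) (hy : SqSum b y) (hz : z ∈ x +ₘ y) : SqSum b z := IsSum.add hx hy hz

theorem sq_mul_left (hx : SqSum b x) (m : A) (hm : SqSum 1 m) : SqSum b (m * x) := by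
  simpa using hm.mul hx

end SqSum

section Positivstellensatz

variable {A : Type u} [MultiringStr A] [IsMultiring A]

/-- The preordering generated by `-p` and `-q`. -/
theorem isPreordering_neg_neg (p q : A) :
    IsPreordering {z | IsSum (sqMul 1 ∪ (sqMul (-p) ∪ (sqMul (-q) ∪ sqMul (p * q)))) z} where
  add a ha b hb z hz := IsSum.add ha hb hz
  mul a ha b hb := by
    refine IsSum.mul ?_ ha hb
    rintro _ (⟨s, rfl⟩ | ⟨s, rfl⟩ | ⟨s, rfl⟩ | ⟨s, rfl⟩) _
      (⟨t, rfl⟩ | ⟨t, rfl⟩ | ⟨t, rfl⟩ | ⟨t, rfl⟩) <;> refine .of_mem ?_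
    · exact .inl ⟨s * t, by simp; ac_rfl⟩
    · exact .inr (.inl ⟨s * t, by simp; ac_rfl⟩)
    · exact .inr (.inr (.inl ⟨s * t, by simp; ac_rfl⟩))
    · exact .inr (.inr (.inr ⟨s * t, by simp; ac_rfl⟩))
    · exact .inr (.inl ⟨s * t, by simp; ac_rfl⟩)
    · exact .inl ⟨s * t * p, by simp; ac_rfl⟩
    · exact .inr (.inr (.inr ⟨s * t, by simp; ac_rfl⟩))
    · exact .inr (.inr (.inl ⟨s * t * p, by simp; ac_rfl⟩))
    · exact .inr (.inr (.inl ⟨s * t, by simp; ac_rfl⟩))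
    · exact .inr (.inr (.inr ⟨s * t, by simp; ac_rfl⟩))
    · exact .inl ⟨s * t * q, by simp; ac_rfl⟩
    · exact .inr (.inl ⟨s * t * q, by simp; ac_rfl⟩)
    · exact .inr (.inr (.inr ⟨s * t, by simp; ac_rfl⟩))
    · exact .inr (.inr (.inl ⟨s * t * p, by simp; ac_rfl⟩))
    · exact .inr (.inl ⟨s * t * q, by simp; ac_rfl⟩)
    · exact .inl ⟨s * t * p * q, by simp; ac_rfl⟩
  sq a := .of_mem (.inl ⟨a, by simp⟩)

/-- The certificate provided by the Positivstellensatz if `a` vanishes at all orders at which `p` and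
`q` are not positive. -/
theorem exists_certificate {a p q : A} (h : ∀ σ : RealSpec A, σ a ≠ 0 → 0 < σ p ∨ 0 < σ q) :
    ∃ e x y z w : A, (∀ σ : RealSpec A, σ a ≠ 0 → 0 < σ e) ∧
      SqSum 1 e ∧ SqSum p x ∧ SqSum q y ∧ SqSum (-(p * q)) z ∧ w ∈ y +ₘ z ∧ e ∈ x +ₘ w := by
  have hT := isPreordering_neg_neg p q
  set T := {z | IsSum (sqMul 1 ∪ (sqMul (-p) ∪ (sqMul (-q) ∪ sqMul (p * q)))) z}
  have hS : ∀ s ∈ Submonoid.powers (a * a), SqSum 1 s ∧ ∀ σ : RealSpec A, σ a ≠ 0 → 0 < σ s := by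
    intro s hs
    let P : Submonoid A :=
      { carrier := {s | SqSum 1 s ∧ ∀ σ : RealSpec A, σ a ≠ 0 → 0 < σ s}
        one_mem' := ⟨.one, fun σ _ => by rw [σ.map_one]; decide⟩
        mul_mem' := fun {x y} hx hy => ⟨hy.1.sq_mul_left x hx.1, fun σ hσ => by
          rw [σ.map_mul]
          exact SignType.mul_pos' (hx.2 σ hσ) (hy.2 σ hσ)⟩ }
    refine Submonoid.powers_le (P := P).2 ?_ hs
    · refine ⟨.mul_self a, fun σ hσ => ?_⟩
      rw [σ.map_mul]
      revert hσ
      generalize σ a = x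
      revert x
      decide
  obtain ⟨s, hs, hsT⟩ : ∃ s ∈ Submonoid.powers (a * a), -s ∈ T := by
    -- Otherwise some order is nonnegative on `T` and nonzero on the powers of `a * a`: there `a`
    -- does not vanish while `p` and `q` are not positive.
    by_contra! hcon
    obtain ⟨σ, hσ, hσ'⟩ := hT.exists_order (Submonoid.powers (a * a))
      (fun s hs => IsSum.bind (fun _ h => .of_mem (.inl h)) (hS s hs).1) hcon
    have ha : σ a ≠ 0 := fun h0 => hσ' _ (Submonoid.mem_powers _) (by
      rw [σ.map_mul, h0, zero_mul])
    have hp := hσ (-p) (.of_mem (.inr (.inl ⟨1, by simp⟩)))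
    have hq := hσ (-q) (.of_mem (.inr (.inr (.inl ⟨1, by simp⟩))))
    have := h σ ha
    rw [σ.map_neg] at hp hq
    revert hp hq this
    generalize σ p = p
    generalize σ q = q
    revert p q
    decide
  obtain ⟨t, n, ht, hn, h1⟩ := IsSum.split hsT
  obtain ⟨x, m, hx, hm, h2⟩ := IsSum.split hn
  obtain ⟨y, z, hy, hz, h3⟩ := IsSum.split hm
  -- Here `t` is the sum-of-squares part of `-s` and `n` the part involving `p` and `q`. So `e = -n`
  -- is a sum of squares, positive where `s` is, and also a combination of `p`, `q` and `-(p * q)`.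
  have he : -n ∈ s +ₘ t := by simpa using neg_mem (mem_sub_left h1)
  refine ⟨-n, -x, -y, -z, -m, fun σ hσ => ?_, ?_, ?_, ?_, ?_, neg_mem h3, neg_mem h2⟩
  · exact SignType.pos_of_mem_hadd (σ.map_hadd _ _ _ he) ((hS s hs).2 σ hσ) (SqSum.nonneg σ ht)
  · exact (hS s hs).1.add ht he
  · exact SqSum.neg' hx
  · exact SqSum.neg' hy
  · exact SqSum.neg hz

/-- If `p` or `q` is positive wherever `a` does not vanish, there is a combination of `p` and `q` that
is nowhere negative, and positive where `p` is positive. -/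
theorem exists_combination_pos_left {a p q : A}
    (h : ∀ σ : RealSpec A, σ a ≠ 0 → 0 < σ p ∨ 0 < σ q) (h0 : ∀ σ : RealSpec A, 0 < σ p → σ a ≠ 0) :
    ∃ f, IsSum (sqMul p ∪ sqMul q) f ∧ (∀ σ : RealSpec A, 0 ≤ σ f) ∧
      ∀ σ : RealSpec A, 0 < σ p → 0 < σ f := by
  obtain ⟨e, x, y, z, w, hea, he, hx, hy, hz, hw, hew⟩ := exists_certificate h
  -- In the certificate `x` may vanish where `p` is positive. Multiplying `e` by a square of `1 + p`
  -- replaces `x` by some `x' ∈ e * n + m * x`, which is positive there.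
  obtain ⟨v, hv⟩ := hadd_nonempty 1 p
  -- `v * v ∈ m + n`, `m ∈ 1 + p * p`, `n ∈ p + p`
  obtain ⟨m, hm, n, hn, hvmn⟩ := hadd_hadd_hadd_comm (mul_mem_hadd _ _ _ v hv)
    (by simpa using hv) (mem_comm (mul_mem_hadd_left p hv))
  rw [mul_one] at hn
  have hmS : SqSum 1 m := SqSum.add .one (.mul_self p) hm
  have hnp : SqSum p n := SqSum.add (.self p) (.self p) hn
  obtain ⟨x', hx', hE⟩ := hadd_assoc_symm (mem_comm (mul_mem_hadd_left e hvmn))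
    (mul_comm m e ▸ mul_mem_hadd_left m hew)
  obtain ⟨u, hu, hE⟩ := hadd_assoc_symm hE (mem_comm (mul_mem_hadd_left m hw))
  have hx'p : SqSum p x' := .add (hnp.sq_mul_left e he) (hx.sq_mul_left m hmS) hx'
  have hyq := hy.sq_mul_left m hmS
  have hzpq := hz.sq_mul_left m hmS
  have hE1 : SqSum 1 (e * (v * v)) := .sq_mul_left (.mul_self v) e he
  generalize m * y = y' at *
  generalize m * z = z' at *
  -- `u * u = (x' + z') * E - (x' + z') * y'`
  obtain ⟨F, hF, G, hG, hFG⟩ := hadd_hadd_hadd_comm (mul_mem_hadd_left u (mem_sub_right hE))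
    (mul_mem_hadd _ _ _ (e * (v * v)) hu) (by
      rw [mul_neg, ← neg_mul]
      exact mem_comm (mul_mem_hadd _ _ _ y' (neg_mem hu)))
  have hf := mul_mem_hadd _ _ _ p hF
  have h1 : SqSum 1 (x' * (e * (v * v)) * p) := by
    have := (hx'p.mul hE1).mul (SqSum.self p)
    exact SqSum.bind (.of_mem ⟨p, by simp⟩) this
  have h2 : SqSum 1 (-z' * y' * p) := by
    have := (hzpq.neg'.mul hyq).mul (SqSum.self p)
    exact SqSum.bind (.of_mem ⟨p * q, by simp; ac_rfl⟩) this
  -- With `E = e * (v * v)`, `F ∈ x' * E - z' * y'`. As `x'`, `y'`, `z'` are multiples of `p`, `q`,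
  -- `-(p * q)` by sums of squares, both terms of `F * p` are sums of squares. Also `F * p ∈ u * u *
  -- p - G * p`, where `-G * p` is a sum of square multiples of `q`.
  refine ⟨F * p, ?_, fun σ => ?_, fun σ hσ => ?_⟩
  · refine IsSum.add (.of_mem (.inl ⟨u, rfl⟩)) ?_ (mul_mem_hadd _ _ _ p (mem_sub_right hFG))
    have h3 : SqSum q (-G * p) := by
      refine SqSum.add ?_ ?_ (mul_mem_hadd _ _ _ p (neg_mem hG))
      · rw [← neg_mul]
        have := (hzpq.neg'.mul hE1).mul (SqSum.self p)
        exact SqSum.bind (.of_mem ⟨p, by simp; ac_rfl⟩) this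
      · rw [neg_mul x', neg_neg]
        have := (hx'p.mul hyq).mul (SqSum.self p)
        exact SqSum.bind (.of_mem ⟨p, by ac_rfl⟩) this
    exact IsSum.bind (fun _ h => .of_mem (.inr h)) h3
  · exact SignType.nonneg_of_mem_hadd (σ.map_hadd _ _ _ hf) (h1.nonneg σ) (h2.nonneg σ)
  · refine SignType.pos_of_mem_hadd (σ.map_hadd _ _ _ hf) ?_ (h2.nonneg σ)
    have hv0 : 0 < σ v := SignType.pos_of_mem_hadd (σ.map_hadd _ _ _ hv)
      (by rw [σ.map_one]; decide) hσ.le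
    have he0 := hea σ (h0 σ hσ)
    have hn0 : 0 < σ n := SignType.pos_of_mem_hadd (σ.map_hadd _ _ _ hn) hσ hσ.le
    have hx0 : 0 < σ x' := by
      refine SignType.pos_of_mem_hadd (σ.map_hadd _ _ _ hx') ?_ ?_
      · rw [σ.map_mul]
        exact SignType.mul_pos' he0 hn0
      · rcases (hx.sq_mul_left m hmS).sign_eq σ with h | h
        · exact h.ge
        · exact h ▸ hσ.le
    simp only [σ.map_mul]
    exact SignType.mul_pos' (SignType.mul_pos' hx0 (SignType.mul_pos' he0
      (SignType.mul_pos' hv0 hv0))) hσ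

end Positivstellensatz

/-! ### The real reduced quotient -/

section Representatives

variable {A : Type u} [MultiringStr A] {a b c x y z : A}

/-- `a` and `b` have the same sign at every order. -/
def SameSign (a b : A) : Prop := ∀ σ : RealSpec A, σ a = σ b

/-- At every order `a` vanishes or has the sign of `b`. -/
def SignLE (a b : A) : Prop := ∀ σ : RealSpec A, σ a = 0 ∨ σ a = σ b

theorem SignLE.add (hx : SignLE x a) (hy : SignLE y a) (hz : z ∈ x +ₘ y) : SignLE z a := by
  intro σ
  have h := σ.map_hadd _ _ _ hz
  have hx := hx σ
  have hy := hy σ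
  revert h hx hy
  generalize σ x = x
  generalize σ y = y
  generalize σ z = z
  generalize σ a = a
  revert x y z a
  decide

theorem SameSign.add (hx : SameSign x a) (hy : SignLE y a) (hz : z ∈ x +ₘ y) : SameSign z a := by
  intro σ
  have h := σ.map_hadd _ _ _ hz
  have hx := hx σ
  have hy := hy σ
  revert h hx hy
  generalize σ x = x
  generalize σ y = y
  generalize σ z = z
  generalize σ a = a
  revert x y z a
  decide

theorem SqSum.signLE (h : SqSum b a) : SignLE a b := fun σ => h.sign_eq σ

variable [IsMultiring A]

/-- If at every order at which `a` does not vanish its sign is that of `b` or that of `c`, then some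
element with the signs of `a` is a combination of `b` and `c`. -/
theorem exists_sameSign_mem_hadd
    (h : ∀ σ : RealSpec A, σ a ≠ 0 → σ a = σ b ∨ σ a = σ c) :
    ∃ x y z, SameSign x a ∧ SqSum b y ∧ SqSum c z ∧ x ∈ y +ₘ z := by
  have pos_iff : ∀ b, ∀ σ : RealSpec A, 0 < σ (a * b) ↔ σ a ≠ 0 ∧ σ a = σ b := by
    intro b σ
    rw [σ.map_mul]
    generalize σ a = a
    generalize σ b = b
    revert a b
    decide
  -- Positivity of `a * b` or `a * c` says that `a` is nonzero with the sign of `b` or `c`. The two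
  -- combinations cover one case each, so an element of their sum is positive wherever `a` does not
  -- vanish. Multiplication by `a` then restores the sign of `a` and turns multiples of `a * b` into
  -- square multiples of `b`.
  obtain ⟨f, hf, hf0, hfp⟩ := exists_combination_pos_left (a := a) (p := a * b) (q := a * c)
    (fun σ hσ => (h σ hσ).imp (fun h' => (pos_iff b σ).2 ⟨hσ, h'⟩)
      fun h' => (pos_iff c σ).2 ⟨hσ, h'⟩) (fun σ hσ => ((pos_iff b σ).1 hσ).1)
  obtain ⟨g, hg, hg0, hgp⟩ := exists_combination_pos_left (a := a) (p := a * c) (q := a * b)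
    (fun σ hσ => (h σ hσ).symm.imp (fun h' => (pos_iff c σ).2 ⟨hσ, h'⟩)
      fun h' => (pos_iff b σ).2 ⟨hσ, h'⟩) (fun σ hσ => ((pos_iff c σ).1 hσ).1)
  obtain ⟨k, hk⟩ := hadd_nonempty f g
  have hkS : IsSum (sqMul (a * b) ∪ sqMul (a * c)) k :=
    IsSum.add hf (by rwa [Set.union_comm]) hk
  have hkpos : ∀ σ : RealSpec A, σ a ≠ 0 → 0 < σ k := by
    intro σ hσ
    rcases h σ hσ with h' | h'
    · exact SignType.pos_of_mem_hadd (σ.map_hadd _ _ _ hk) (hfp σ ((pos_iff b σ).2 ⟨hσ, h'⟩))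
        (hg0 σ)
    · exact SignType.pos_of_mem_hadd (σ.map_hadd _ _ _ (mem_comm hk))
        (hgp σ ((pos_iff c σ).2 ⟨hσ, h'⟩)) (hf0 σ)
  obtain ⟨y, z, hy, hz, hyz⟩ := IsSum.split hkS
  refine ⟨a * k, a * y, a * z, fun σ => ?_, ?_, ?_, mul_mem_hadd_left a hyz⟩
  · have := hkpos σ
    rw [σ.map_mul]
    revert this
    generalize σ a = a
    generalize σ k = k
    revert a k
    decide
  · exact SqSum.bind (.of_mem ⟨a, by ac_rfl⟩) ((SqSum.self a).mul hy)
  · exact SqSum.bind (.of_mem ⟨a, by ac_rfl⟩) ((SqSum.self a).mul hz)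

/-- `ZeroSum a b c d`: zero belongs to `a + b + c + d`. -/
def ZeroSum (a b c d : A) : Prop := ∃ k ∈ a +ₘ b, -k ∈ c +ₘ d

theorem ZeroSum.swap_left {a b c d : A} : ZeroSum a b c d → ZeroSum b a c d :=
  fun ⟨k, hk, hk'⟩ => ⟨k, mem_comm hk, hk'⟩

theorem ZeroSum.swap {a b c d : A} : ZeroSum a b c d → ZeroSum c d a b :=
  fun ⟨k, hk, hk'⟩ => ⟨-k, hk', by rwa [neg_neg]⟩

theorem ZeroSum.add {a b c d a' b' c' d' : A} (h : ZeroSum a b c d) (h' : ZeroSum a' b' c' d') :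
    ∃ x ∈ a +ₘ a', ∃ y ∈ b +ₘ b', ∃ z ∈ c +ₘ c', ∃ w ∈ d +ₘ d', ZeroSum x y z w := by
  obtain ⟨k, hk, hk'⟩ := h
  obtain ⟨l, hl, hl'⟩ := h'
  obtain ⟨m, hm⟩ := hadd_nonempty k l
  obtain ⟨x, hx, y, hy, h1⟩ := hadd_hadd_hadd_comm hm hk hl
  obtain ⟨z, hz, w, hw, h2⟩ := hadd_hadd_hadd_comm (neg_mem hm) hk' hl'
  exact ⟨x, hx, y, hy, z, hz, w, hw, m, h1, h2⟩

/-- If `g ∈ a + b` and `-g ∈ c + d` at every order, there is a zero sum in which the first term has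
the signs of `a` and the others are dominated by `b`, `c` and `d`. -/
theorem exists_zeroSum_left {a b c d g : A} (h : ∀ σ : RealSpec A, σ g ∈ σ a +ₘ σ b)
    (h' : ∀ σ : RealSpec A, -σ g ∈ σ c +ₘ σ d) :
    ∃ x y z w, SameSign x a ∧ SignLE y b ∧ SignLE z c ∧ SignLE w d ∧ ZeroSum x y z w := by
  -- `g' ∈ -z - w` has the signs of `g`, and `x ∈ k - y` with `k` a sum of multiples of `g'`
  obtain ⟨g', z, w, hg', hz, hw, hzw⟩ := exists_sameSign_mem_hadd (a := g) (b := -c) (c := -d) (by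
    intro σ
    have := h' σ
    rw [σ.map_neg, σ.map_neg]
    revert this
    generalize σ g = g
    generalize σ c = c
    generalize σ d = d
    revert g c d
    decide)
  obtain ⟨x, k, y, hx, hk, hy, hxy⟩ := exists_sameSign_mem_hadd (a := a) (b := g') (c := -b) (by
    intro σ
    have := h σ
    rw [σ.map_neg, hg' σ]
    revert this
    generalize σ g = g
    generalize σ a = a
    generalize σ b = b
    revert g a b
    decide)
  have hk' : IsSum (sqMul (-c) ∪ sqMul (-d)) k := by
    refine IsSum.bind ?_ hk
    rintro _ ⟨s, rfl⟩
    refine IsSum.add ?_ ?_ (mul_mem_hadd_left (s * s) hzw)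
    · exact IsSum.bind (fun _ h => .of_mem (.inl h)) (hz.sq_mul_left _ (.mul_self s))
    · exact IsSum.bind (fun _ h => .of_mem (.inr h)) (hw.sq_mul_left _ (.mul_self s))
  obtain ⟨z', w', hz', hw', hk''⟩ := IsSum.split hk'
  exact ⟨x, -y, -z', -w', hx, (SqSum.neg' hy).signLE, (SqSum.neg' hz').signLE,
    (SqSum.neg' hw').signLE, k, mem_sub_right hxy, neg_mem hk''⟩

/-- Representatives for a sum of three elements. -/
theorem exists_representatives {a b c g x : A} (h : ∀ σ : RealSpec A, σ x ∈ σ g +ₘ σ c)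
    (h' : ∀ σ : RealSpec A, σ g ∈ σ a +ₘ σ b) :
    ∃ x' a' b' c' k, SameSign x' x ∧ SameSign a' a ∧ SameSign b' b ∧ SameSign c' c ∧
      k ∈ b' +ₘ c' ∧ x' ∈ a' +ₘ k := by
  have h1 : ∀ σ : RealSpec A, -σ g ∈ σ (-x) +ₘ σ c := fun σ => by
    have := neg_mem (mem_sub_right (h σ))
    rwa [neg_neg, ← σ.map_neg x] at this
  have h2 : ∀ σ : RealSpec A, -σ (-g) ∈ σ a +ₘ σ b := fun σ => by
    rw [σ.map_neg, neg_neg]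
    exact h' σ
  have h3 : ∀ σ : RealSpec A, σ (-g) ∈ σ (-x) +ₘ σ c := fun σ => by
    rw [σ.map_neg g]
    exact h1 σ
  -- Each of four zero sums has the exact sign in one of the positions `a`, `b`, `-x`, `c` and
  -- dominated signs in the others. Adding dominated terms does not change a sign, so the total is
  -- exact in every position.
  obtain ⟨a1, b1, x1, c1, ha1, hb1, hx1, hc1, e1⟩ := exists_zeroSum_left h' h1
  obtain ⟨b2, a2, x2, c2, hb2, ha2, hx2, hc2, e2⟩ :=
    exists_zeroSum_left (fun σ => mem_comm (h' σ)) h1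
  obtain ⟨x3, c3, a3, b3, hx3, hc3, ha3, hb3, e3⟩ := exists_zeroSum_left h3 h2
  obtain ⟨c4, x4, a4, b4, hc4, hx4, ha4, hb4, e4⟩ :=
    exists_zeroSum_left (fun σ => mem_comm (h3 σ)) h2
  obtain ⟨a5, ha5, b5, hb5, x5, hx5, c5, hc5, e5⟩ := e1.add e2.swap_left
  obtain ⟨a6, ha6, b6, hb6, x6, hx6, c6, hc6, e6⟩ := e3.swap.add e4.swap_left.swap
  obtain ⟨a', ha', b', hb', x', hx', c', hc', k, hk, hk'⟩ := e5.add e6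
  obtain ⟨m, hm, hm'⟩ := hadd_assoc a' b' c' k (-x') (mem_sub_right hk' |> fun h => by
    simpa using neg_mem h) hk
  refine ⟨-x', a', b', c', m, fun σ => ?_, ?_, ?_, ?_, hm, hm'⟩
  · have : SameSign x' (-x) := by
      have h6 : SameSign x6 (-x) := hx3.add hx4 hx6
      exact h6.add (hx1.add hx2 hx5) (mem_comm hx')
    rw [σ.map_neg, this σ, σ.map_neg, neg_neg]
  · exact SameSign.add (ha1.add ha2 ha5) (ha3.add ha4 ha6) ha'
  · exact SameSign.add (hb2.add hb1 (mem_comm hb5)) (hb3.add hb4 hb6) hb'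
  · exact (hc4.add hc3 (mem_comm hc6)).add (hc1.add hc2 hc5) (mem_comm hc')

end Representatives

namespace RRQuot

variable {A : Type u} [MultiringStr A]

theorem mk'_surjective (x : RRQuot A) : ∃ a, mk' a = x := by
  obtain ⟨v, a, ha⟩ := x
  exact ⟨a, RRQuot.ext (funext fun σ => (ha σ).symm)⟩

theorem mk'_eq {a b : A} : mk' a = mk' b ↔ SameSign a b :=
  ⟨fun h σ => congrArg (fun x => x.val σ) h, fun h => RRQuot.ext (funext h)⟩

/-- The order of `Q(A)` induced by an order of `A`. -/
def order (σ : RealSpec A) : RealSpec (RRQuot A) where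
  toFun x := x.val σ
  map_hadd := by
    rintro _ _ _ ⟨a, b, c, rfl, rfl, rfl, h⟩
    exact σ.map_hadd _ _ _ h
  map_mul _ _ := rfl
  map_zero := σ.map_zero
  map_one := σ.map_one
  map_neg _ := rfl

variable [IsMultiring A]

/-- The sum of `Q(A)` is computed order by order. -/
theorem mem_hadd_iff {x y z : RRQuot A} :
    x ∈ y +ₘ z ↔ ∀ σ : RealSpec A, x.val σ ∈ y.val σ +ₘ z.val σ := by
  refine ⟨fun h σ => (order σ).map_hadd _ _ _ h, fun h => ?_⟩
  obtain ⟨a, rfl⟩ := mk'_surjective x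
  obtain ⟨b, rfl⟩ := mk'_surjective y
  obtain ⟨c, rfl⟩ := mk'_surjective z
  -- The sum is read as `b + 0 + c`: the representative `z'` of zero vanishes at all orders, so `k ∈
  -- z' + c'` has the signs of `c`.
  obtain ⟨a', b', z', c', k, ha, hb, hz, hc, hk, h'⟩ := exists_representatives (A := A) (a := b)
    (b := 0) (c := c) (g := b) (x := a) h (fun σ => by rw [σ.map_zero]; exact mem_add_zero _)
  refine ⟨a', b', k, mk'_eq.2 ha, mk'_eq.2 hb, mk'_eq.2 fun σ => ?_, h'⟩
  have := σ.map_hadd _ _ _ hk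
  rw [hz σ, σ.map_zero, mem_zero_hadd] at this
  rw [this, hc σ]

/-- Associativity is not a pointwise matter: the intermediate sum must be the class of one element
of `A`, which `exists_representatives` provides. -/
instance : IsMultiring (RRQuot A) where
  hadd_nonempty x y := by
    obtain ⟨a, rfl⟩ := mk'_surjective x
    obtain ⟨b, rfl⟩ := mk'_surjective y
    obtain ⟨c, hc⟩ := hadd_nonempty a b
    exact ⟨mk' c, c, a, b, rfl, rfl, rfl, hc⟩
  mem_neg_hadd x y z h := mem_hadd_iff.2 fun σ => mem_neg_hadd _ _ _ (mem_hadd_iff.1 h σ)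
  mem_hadd_neg x y z h := mem_hadd_iff.2 fun σ => mem_hadd_neg _ _ _ (mem_hadd_iff.1 h σ)
  mem_hadd_zero x y := by
    rw [mem_hadd_iff, RRQuot.ext_iff, funext_iff]
    refine forall_congr' fun σ => ?_
    rw [show (0 : RRQuot A).val σ = 0 from σ.map_zero, mem_hadd_zero]
  hadd_assoc x y z g w hw hg := by
    obtain ⟨a, rfl⟩ := mk'_surjective x
    obtain ⟨b, rfl⟩ := mk'_surjective y
    obtain ⟨c, rfl⟩ := mk'_surjective z
    obtain ⟨g, rfl⟩ := mk'_surjective g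
    obtain ⟨w, rfl⟩ := mk'_surjective w
    obtain ⟨w', a', b', c', k, hw', ha, hb, hc, hk, h⟩ :=
      exists_representatives (mem_hadd_iff.1 hw) (mem_hadd_iff.1 hg)
    exact ⟨mk' k, ⟨k, b', c', rfl, mk'_eq.2 hb, mk'_eq.2 hc, hk⟩,
      ⟨w', a', k, mk'_eq.2 hw', mk'_eq.2 ha, rfl, h⟩⟩
  hadd_comm x y := Set.ext fun z => by
    rw [mem_hadd_iff, mem_hadd_iff]
    exact forall_congr' fun σ => by rw [hadd_comm]
  mul_mem_hadd x y z w h := mem_hadd_iff.2 fun σ => mul_mem_hadd _ _ _ _ (mem_hadd_iff.1 h σ)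

end RRQuot

/-! ### Localizations -/

namespace Localization

variable {A : Type u} [MultiringStr A] {S : Submonoid A}

theorem mk_eq_mk_of_mul {a b : A} {s t u : S} (h : t = s * u) (h' : b = a * u) :
    mk a s = mk b t := by
  subst h h'
  rw [mk_eq_mk_iff]
  exact r_iff_exists.2 ⟨1, by simp only [Submonoid.coe_mul]; ac_rfl⟩

theorem exists_mk (x : Localization S) : ∃ a s, x = mk a s :=
  induction_on x fun y => ⟨y.1, y.2, rfl⟩

theorem exists_common_denominator (x y z w : Localization S) :
    ∃ a b c e d, x = mk a d ∧ y = mk b d ∧ z = mk c d ∧ w = mk e d := by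
  obtain ⟨a, s, rfl⟩ := exists_mk x
  obtain ⟨b, t, rfl⟩ := exists_mk y
  obtain ⟨c, u, rfl⟩ := exists_mk z
  obtain ⟨e, v, rfl⟩ := exists_mk w
  refine ⟨a * (t * u * v : S), b * (s * u * v : S), c * (s * t * v : S), e * (s * t * u : S),
    s * t * u * v, mk_eq_mk_of_mul ?_ rfl, mk_eq_mk_of_mul ?_ rfl, mk_eq_mk_of_mul ?_ rfl,
    mk_eq_mk_of_mul ?_ rfl⟩ <;> ac_rfl

theorem zero_eq_mk (s : S) : (0 : Localization S) = mk 0 s := (mk_zero s).symm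

variable [IsMultiring A]

/-- The condition does not depend on the chosen fractions: the given relation is multiplied by the
denominators and by the witnesses of the equalities of fractions. -/
theorem mem_hadd_mk_iff {a b c : A} {s t u : S} :
    mk a s ∈ mk b t +ₘ mk c u ↔
      ∃ v ∈ S, a * t * u * v ∈ (b * s * u * v) +ₘ (c * s * t * v) := by
  refine ⟨?_, fun ⟨v, hv, h⟩ => ⟨a, b, c, s, t, u, rfl, rfl, rfl, v, hv, h⟩⟩
  rintro ⟨a', b', c', s', t', u', ha, hb, hc, v, hv, h⟩
  obtain ⟨w, hw⟩ := r_iff_exists.1 (mk_eq_mk_iff.1 ha)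
  obtain ⟨x, hx⟩ := r_iff_exists.1 (mk_eq_mk_iff.1 hb)
  obtain ⟨y, hy⟩ := r_iff_exists.1 (mk_eq_mk_iff.1 hc)
  refine ⟨v * ((s' : A) * t' * u' * w * x * y), S.mul_mem hv (s' * t' * u' * w * x * y).2, ?_⟩
  refine mem_hadd_congr ?_ ?_ ?_ (mul_mem_hadd _ _ _ ((s : A) * t * u * w * x * y) h) <;> symm
  · calc _ = (w * (s' * a)) * (t * u * v * t' * u' * x * y) := by ac_rfl
      _ = (w * (s * a')) * (t * u * v * t' * u' * x * y) := by rw [hw]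
      _ = _ := by ac_rfl
  · calc _ = (x * (t' * b)) * (s * u * v * s' * u' * w * y) := by ac_rfl
      _ = (x * (t * b')) * (s * u * v * s' * u' * w * y) := by rw [hx]
      _ = _ := by ac_rfl
  · calc _ = (y * (u' * c)) * (s * t * v * s' * t' * w * x) := by ac_rfl
      _ = (y * (u * c')) * (s * t * v * s' * t' * w * x) := by rw [hy]
      _ = _ := by ac_rfl

theorem mem_hadd_mk_iff_of_same {a b c : A} {d : S} :
    mk a d ∈ mk b d +ₘ mk c d ↔ ∃ v ∈ S, a * v ∈ (b * v) +ₘ (c * v) := by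
  rw [mem_hadd_mk_iff]
  constructor
  · rintro ⟨v, hv, h⟩
    exact ⟨d * d * v, S.mul_mem (S.mul_mem d.2 d.2) hv, by simpa only [mul_assoc] using h⟩
  · rintro ⟨v, hv, h⟩
    refine ⟨v, hv, ?_⟩
    refine mem_hadd_congr ?_ ?_ ?_ (mul_mem_hadd _ _ _ (d * d : A) h) <;> ac_rfl

instance : IsMultiring (Localization S) where
  hadd_nonempty x y := by
    obtain ⟨a, b, -, -, d, rfl, rfl, -⟩ := exists_common_denominator x y x x
    obtain ⟨c, hc⟩ := hadd_nonempty a b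
    exact ⟨mk c d, mem_hadd_mk_iff_of_same.2 ⟨1, S.one_mem, by simpa using hc⟩⟩
  mem_neg_hadd x y z h := by
    obtain ⟨a, b, c, -, d, rfl, rfl, rfl, -⟩ := exists_common_denominator x y z x
    obtain ⟨v, hv, h⟩ := mem_hadd_mk_iff_of_same.1 h
    exact mem_hadd_mk_iff_of_same.2 ⟨v, hv, by
      rw [neg_mul]
      exact mem_neg_hadd _ _ _ h⟩
  mem_hadd_neg x y z h := by
    obtain ⟨a, b, c, -, d, rfl, rfl, rfl, -⟩ := exists_common_denominator x y z x
    obtain ⟨v, hv, h⟩ := mem_hadd_mk_iff_of_same.1 h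
    exact mem_hadd_mk_iff_of_same.2 ⟨v, hv, by
      rw [neg_mul]
      exact mem_hadd_neg _ _ _ h⟩
  mem_hadd_zero x y := by
    obtain ⟨a, b, -, -, d, rfl, rfl, -⟩ := exists_common_denominator x y x x
    rw [zero_eq_mk d, mem_hadd_mk_iff_of_same]
    simp only [zero_mul, IsMultiring.mem_hadd_zero]
    rw [mk_eq_mk_iff, r_iff_exists]
    constructor
    · rintro ⟨v, hv, h⟩
      exact ⟨⟨v, hv⟩, by
        calc v * (d * a) = d * (a * v) := by ac_rfl
          _ = d * (b * v) := by rw [h]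
          _ = v * (d * b) := by ac_rfl⟩
    · rintro ⟨v, h⟩
      exact ⟨v * d, S.mul_mem v.2 d.2, by
        calc a * (v * d) = v * (d * a) := by ac_rfl
          _ = v * (d * b) := h
          _ = b * (v * d) := by ac_rfl⟩
  hadd_assoc x y z g w hw hg := by
    obtain ⟨a, b, c, g, d, rfl, rfl, rfl, rfl⟩ := exists_common_denominator x y z g
    obtain ⟨e, s, rfl⟩ := exists_mk w
    have cancel (f : A) (u : S) : mk f d = mk (f * u) (d * u) := mk_eq_mk_of_mul rfl rfl
    rw [mk_eq_mk_of_mul (a := e) (s := s) (mul_comm d s) rfl] at hw ⊢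
    rw [cancel g s, cancel c s, mem_hadd_mk_iff_of_same] at hw
    rw [mem_hadd_mk_iff_of_same] at hg
    obtain ⟨v, hv, hw⟩ := hw
    obtain ⟨w, hw', hg⟩ := hg
    obtain ⟨h, hh, hxh⟩ := IsMultiring.hadd_assoc (a * w * (s * v)) (b * w * (s * v))
      (c * w * (s * v)) (g * w * (s * v)) (e * d * v * w)
      (mem_hadd_congr rfl (by ac_rfl) (by ac_rfl) (IsMultiring.mul_mem_hadd _ _ _ w hw))
      (IsMultiring.mul_mem_hadd _ _ _ _ hg)
    refine ⟨mk h (d * (s * ⟨v, hv⟩ * ⟨w, hw'⟩)), ?_, ?_⟩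
    · rw [cancel b, cancel c, mem_hadd_mk_iff_of_same]
      refine ⟨1, S.one_mem, mem_hadd_congr (mul_one _).symm ?_ ?_ hh⟩ <;>
        simp only [Submonoid.coe_mul, mul_one] <;> ac_rfl
    · rw [cancel a (s * ⟨v, hv⟩ * ⟨w, hw'⟩), mk_eq_mk_of_mul (a := e * d) (s := d * s)
        (u := ⟨v, hv⟩ * ⟨w, hw'⟩) (t := d * (s * ⟨v, hv⟩ * ⟨w, hw'⟩)) (by ac_rfl) rfl,
        mem_hadd_mk_iff_of_same]
      refine ⟨1, S.one_mem, mem_hadd_congr ?_ ?_ (mul_one _).symm hxh⟩ <;>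
        simp only [Submonoid.coe_mul, mul_one] <;> ac_rfl
  hadd_comm x y := by
    ext w
    obtain ⟨a, b, c, -, d, rfl, rfl, rfl, -⟩ := exists_common_denominator x y w x
    simp only [mem_hadd_mk_iff_of_same, IsMultiring.hadd_comm (a * _)]
  mul_mem_hadd x y z w h := by
    obtain ⟨a, b, c, e, d, rfl, rfl, rfl, rfl⟩ := exists_common_denominator x y z w
    obtain ⟨v, hv, h⟩ := mem_hadd_mk_iff_of_same.1 h
    simp only [mk_mul]
    refine mem_hadd_mk_iff_of_same.2 ⟨v, hv, ?_⟩
    simpa only [mul_right_comm _ e] using mul_mem_hadd _ _ _ e h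

end Localization

/-! ### The constructible topology -/

namespace MSpec

variable {A : Type u} [MultiringStr A]

theorem isClopen_D (a : A) : IsClopen (D a) :=
  ⟨⟨TopologicalSpace.isOpen_generateFrom_of_mem (.inr ⟨a, rfl⟩)⟩,
    TopologicalSpace.isOpen_generateFrom_of_mem (.inl ⟨a, rfl⟩)⟩

/-- A property of neighbourhoods that holds for the subbasic ones, is monotone and stable under
intersections holds for all neighbourhoods. -/
theorem nhds_induction {p : MSpec A} {P : Set (MSpec A) → Prop} (univ : P Set.univ)
    (mono : ∀ U V, U ⊆ V → P U → P V) (inter : ∀ U V, P U → P V → P (U ∩ V))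
    (D : ∀ a, p ∈ D a → P (D a)) (compl_D : ∀ a, a ∈ p.1.carrier → P (MSpec.D a)ᶜ)
    {U : Set (MSpec A)} (hU : U ∈ nhds p) : P U := by
  let F : Filter (MSpec A) :=
    { sets := {U | P U}
      univ_sets := univ
      sets_of_superset := fun h h' => mono _ _ h' h
      inter_sets := fun h h' => inter _ _ h h' }
  have : F ≤ nhds p := by
    rw [TopologicalSpace.nhds_generateFrom]
    refine le_iInf₂ fun s hs => Filter.le_principal_iff.2 ?_
    obtain ⟨hp, ⟨a, rfl⟩ | ⟨a, rfl⟩⟩ := hs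
    · exact D a hp
    · exact compl_D a (not_not.1 hp)
  exact this hU

/-- An ultrafilter `F` converges to the prime ideal of those `a` that lie in `F`-almost every prime.
-/
instance : CompactSpace (MSpec A) where
  isCompact_univ := by
    rw [isCompact_iff_ultrafilter_le_nhds]
    intro F _
    have hD : ∀ a, (D a)ᶜ ∉ F → D a ∈ F := fun a h => by
      rwa [← Ultrafilter.compl_mem_iff_notMem, compl_compl] at h
    let I : MIdeal A :=
      { carrier := {a | (D a)ᶜ ∈ F}
        zero_mem := Filter.mem_of_superset Filter.univ_mem fun p _ => not_not.2 p.1.zero_mem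
        hadd_subset := fun a ha b hb c hc => Filter.mem_of_superset (Filter.inter_mem ha hb)
          fun p hp => not_not.2 (p.1.hadd_subset _ (not_not.1 hp.1) _ (not_not.1 hp.2) hc)
        mul_mem := fun a b hb => Filter.mem_of_superset hb
          fun p hp => not_not.2 (p.1.mul_mem _ _ (not_not.1 hp)) }
    have hI : I.IsPrime := by
      refine ⟨fun h => ?_, fun a b h => ?_⟩
      · refine F.neBot.ne (Filter.empty_mem_iff_bot.1 (Filter.mem_of_superset h fun p hp => ?_))
        exact hp p.2.1
      · by_contra! hcon
        refine F.neBot.ne (Filter.empty_mem_iff_bot.1 (Filter.mem_of_superset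
          (Filter.inter_mem h (Filter.inter_mem (hD a hcon.1) (hD b hcon.2))) fun p hp => ?_))
        exact hp.1 (mul_mem_D hp.2.1 hp.2.2)
    let p : MSpec A := ⟨I, hI⟩
    refine ⟨p, trivial, ?_⟩
    rw [TopologicalSpace.nhds_generateFrom]
    refine le_iInf₂ fun s hs => Filter.le_principal_iff.2 ?_
    obtain ⟨hp, ⟨a, rfl⟩ | ⟨a, rfl⟩⟩ := hs
    · exact hD a hp
    · exact not_not.1 hp

variable [IsMultiring A]

theorem exists_kfrac (p : MSpec A) (x : p.K) : ∃ a b, ∃ hb : p ∈ D b, x = p.kfrac a b hb := by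
  obtain ⟨a, ⟨b, hb⟩, rfl⟩ := Localization.exists_mk x
  obtain ⟨a, rfl⟩ := MIdeal.toQuo_surj a
  obtain ⟨b, rfl⟩ := MIdeal.toQuo_surj b
  exact ⟨a, b, fun h => hb (p.1.toQuo_eq_zero.2 h), rfl⟩

/-- A relation in `K_A(p)` amounts to relations in `A` in which `p` enters only through `v ∉ p` and
`i ∈ p`, both clopen conditions on `p`. -/
theorem mem_hadd_kfrac_iff {p : MSpec A} {a b c s t u : A} {hs : p ∈ D s} {ht : p ∈ D t}
    {hu : p ∈ D u} : p.kfrac a s hs ∈ p.kfrac b t ht +ₘ p.kfrac c u hu ↔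
      ∃ v, p ∈ D v ∧ ∃ i ∈ p.1.carrier, ∃ z ∈ (b * s * u * v) +ₘ (c * s * t * v),
        a * t * u * v ∈ z +ₘ i := by
  unfold kfrac
  rw [Localization.mem_hadd_mk_iff]
  constructor
  · rintro ⟨v, hv, h⟩
    obtain ⟨v, rfl⟩ := MIdeal.toQuo_surj v
    simp only [← MIdeal.toQuo_mul] at h
    obtain ⟨z, hz, h⟩ := MIdeal.mem_hadd_toQuo _ h
    obtain ⟨i, hi, hz⟩ := (MIdeal.rel_iff _).1 ((MIdeal.toQuo_eq _).1 hz.symm)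
    exact ⟨v, fun h => hv (p.1.toQuo_eq_zero.2 h), i, hi, z, h, hz⟩
  · rintro ⟨v, hv, i, hi, z, h, hz⟩
    refine ⟨p.1.toQuo v, fun h => hv (p.1.toQuo_eq_zero.1 h), ?_⟩
    simp only [← MIdeal.toQuo_mul]
    exact ⟨z, _, _, ((MIdeal.toQuo_eq _).2 ((MIdeal.rel_iff _).2 ⟨i, hi, hz⟩)).symm, rfl, rfl, h⟩

/-- A relation between fractions at `p` holds in a clopen neighbourhood of `p`. -/
theorem mem_hadd_kfrac_nhds {p : MSpec A} {a b c s t u : A} {hs : p ∈ D s} {ht : p ∈ D t}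
    {hu : p ∈ D u} (h : p.kfrac a s hs ∈ p.kfrac b t ht +ₘ p.kfrac c u hu) :
    ∃ U, IsClopen U ∧ p ∈ U ∧ ∀ q ∈ U, ∃ (hs : q ∈ D s) (ht : q ∈ D t) (hu : q ∈ D u),
      q.kfrac a s hs ∈ q.kfrac b t ht +ₘ q.kfrac c u hu := by
  obtain ⟨v, hv, i, hi, z, hz, h⟩ := mem_hadd_kfrac_iff.1 h
  refine ⟨D s ∩ D t ∩ D u ∩ D v ∩ (D i)ᶜ, (((((isClopen_D s).inter (isClopen_D t)).inter
    (isClopen_D u)).inter (isClopen_D v)).inter (isClopen_D i).compl),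
    ⟨⟨⟨⟨hs, ht⟩, hu⟩, hv⟩, not_not.2 hi⟩, fun q hq => ?_⟩
  obtain ⟨⟨⟨⟨hs, ht⟩, hu⟩, hv⟩, hi⟩ := hq
  exact ⟨hs, ht, hu, mem_hadd_kfrac_iff.2 ⟨v, hv, i, not_not.1 hi, z, hz, h⟩⟩

end MSpec

/-! ### The von Neumann hull is a multiring -/

namespace VNHull

variable {A : Type u} [MultiringStr A] [IsMultiring A]

open Classical in
/-- The family equal to `s` on the clopen set `U` and to `t` outside of `U`. -/
noncomputable def piecewise {U : Set (MSpec A)} (hU : IsClopen U) (s t : VNHull A) : VNHull A where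
  val p := if p ∈ U then s.val p else t.val p
  constructible p := by
    by_cases hp : p ∈ U
    · obtain ⟨V, hV, hpV, x, y, h⟩ := s.constructible p
      refine ⟨U ∩ V, hU.inter hV, ⟨hp, hpV⟩, x, y, fun q hq => ?_⟩
      rw [if_pos hq.1]
      exact h q hq.2
    · obtain ⟨V, hV, hpV, x, y, h⟩ := t.constructible p
      refine ⟨Uᶜ ∩ V, hU.compl.inter hV, ⟨hp, hpV⟩, x, y, fun q hq => ?_⟩
      rw [if_neg hq.1]
      exact h q hq.2

theorem piecewise_of_mem {U : Set (MSpec A)} (hU : IsClopen U) (s t : VNHull A) {p : MSpec A}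
    (hp : p ∈ U) : (piecewise hU s t).val p = s.val p := if_pos hp

theorem piecewise_of_notMem {U : Set (MSpec A)} (hU : IsClopen U) (s t : VNHull A) {p : MSpec A}
    (hp : p ∉ U) : (piecewise hU s t).val p = t.val p := if_neg hp

open Classical in
/-- The family equal to `x/y` on the clopen set `U` and to `0` outside of `U`. -/
noncomputable def frac {U : Set (MSpec A)} (hU : IsClopen U) (x y : A) (h : U ⊆ MSpec.D y) :
    VNHull A where
  val p := if hp : p ∈ U then p.kfrac x y (h hp) else 0
  constructible p := by
    by_cases hp : p ∈ U
    · refine ⟨U, hU, hp, x, y, fun q hq => ⟨h hq, ?_⟩⟩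
      rw [dif_pos hq]
    · refine ⟨Uᶜ, hU.compl, hp, 0, 1, fun q hq => ⟨q.one_mem_D, ?_⟩⟩
      rw [dif_neg hq, MSpec.kfrac_zero]

theorem frac_of_mem {U : Set (MSpec A)} (hU : IsClopen U) {x y : A} (h : U ⊆ MSpec.D y)
    {p : MSpec A} (hp : p ∈ U) : (frac hU x y h).val p = p.kfrac x y (h hp) := dif_pos hp

theorem frac_of_notMem {U : Set (MSpec A)} (hU : IsClopen U) {x y : A} (h : U ⊆ MSpec.D y)
    {p : MSpec A} (hp : p ∉ U) : (frac hU x y h).val p = 0 := dif_neg hp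

/-- Elements of the von Neumann hull can be constructed locally. -/
theorem exists_of_local (P : ∀ p : MSpec A, p.K → Prop)
    (h : ∀ p, ∃ U, IsClopen U ∧ p ∈ U ∧ ∃ x y, ∀ q ∈ U, ∃ hy : q ∈ MSpec.D y,
      P q (q.kfrac x y hy)) : ∃ s : VNHull A, ∀ p, P p (s.val p) := by
  -- Finitely many local solutions suffice by compactness. On overlaps `piecewise` keeps the first
  -- one, so they need not agree.
  obtain ⟨W, -, hW, s, hs⟩ := isCompact_univ.induction_on
    (p := fun V : Set (MSpec A) => ∃ W, IsClopen W ∧ V ⊆ W ∧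
      ∃ s : VNHull A, ∀ p ∈ W, P p (s.val p))
    ⟨∅, isClopen_empty, le_rfl, 0, fun _ h => h.elim⟩
    (fun _ _ h ⟨W, hW, hV, hs⟩ => ⟨W, hW, h.trans hV, hs⟩)
    (fun _ _ ⟨W, hW, hV, s, hs⟩ ⟨W', hW', hV', s', hs'⟩ =>
      ⟨W ∪ W', hW.union hW', Set.union_subset_union hV hV', piecewise hW s s', fun p hp => by
        by_cases hpW : p ∈ W
        · rw [piecewise_of_mem hW _ _ hpW]
          exact hs p hpW
        · rw [piecewise_of_notMem hW _ _ hpW]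
          exact hs' p (hp.resolve_left hpW)⟩)
    (fun p _ => by
      obtain ⟨U, hU, hp, x, y, h⟩ := h p
      have hD : U ⊆ MSpec.D y := fun q hq => (h q hq).1
      refine ⟨U, mem_nhdsWithin_of_mem_nhds (hU.isOpen.mem_nhds hp), U, hU, le_rfl,
        frac hU x y hD, fun q hq => ?_⟩
      rw [frac_of_mem hU hD hq]
      exact (h q hq).2)
  exact ⟨s, fun p => hs p (hW trivial)⟩

theorem zero_val (p : MSpec A) : (0 : VNHull A).val p = 0 := rfl

theorem one_val (p : MSpec A) : (1 : VNHull A).val p = 1 := rfl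

theorem mul_val (s t : VNHull A) (p : MSpec A) : (s * t).val p = s.val p * t.val p := rfl

/-- For non-emptiness and associativity, a witness is chosen at one point;
`MSpec.mem_hadd_kfrac_nhds` extends its relations to a neighbourhood and `exists_of_local` glues. -/
instance : IsMultiring (VNHull A) where
  hadd_nonempty s t := by
    refine exists_of_local (fun p z => z ∈ s.val p +ₘ t.val p) fun p => ?_
    obtain ⟨U, hU, hp, x, y, h⟩ := s.constructible p
    obtain ⟨U', hU', hp', x', y', h'⟩ := t.constructible p
    obtain ⟨z, hz⟩ := IsMultiring.hadd_nonempty (s.val p) (t.val p)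
    obtain ⟨a, b, hb, rfl⟩ := p.exists_kfrac z
    rw [(h p hp).2, (h' p hp').2] at hz
    obtain ⟨V, hV, hpV, hz⟩ := MSpec.mem_hadd_kfrac_nhds hz
    refine ⟨U ∩ U' ∩ V, (hU.inter hU').inter hV, ⟨⟨hp, hp'⟩, hpV⟩, a, b, fun q hq => ?_⟩
    rw [(h q hq.1.1).2, (h' q hq.1.2).2]
    obtain ⟨h1, h2, h3, h4⟩ := hz q hq.2
    exact ⟨h1, h4⟩
  mem_neg_hadd _ _ _ h p := IsMultiring.mem_neg_hadd _ _ _ (h p)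
  mem_hadd_neg _ _ _ h p := IsMultiring.mem_hadd_neg _ _ _ (h p)
  mem_hadd_zero s t := by
    rw [VNHull.ext_iff, funext_iff]
    exact forall_congr' fun p => IsMultiring.mem_hadd_zero _ _
  hadd_assoc s t u g w hw hg := by
    suffices ∃ h : VNHull A, ∀ p, h.val p ∈ t.val p +ₘ u.val p ∧ w.val p ∈ s.val p +ₘ h.val p by
      obtain ⟨h, hh⟩ := this
      exact ⟨h, fun p => (hh p).1, fun p => (hh p).2⟩
    refine exists_of_local (fun p z => z ∈ t.val p +ₘ u.val p ∧ w.val p ∈ s.val p +ₘ z) fun p => ?_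
    obtain ⟨U1, hU1, hp1, x1, y1, h1⟩ := s.constructible p
    obtain ⟨U2, hU2, hp2, x2, y2, h2⟩ := t.constructible p
    obtain ⟨U3, hU3, hp3, x3, y3, h3⟩ := u.constructible p
    obtain ⟨U4, hU4, hp4, x4, y4, h4⟩ := w.constructible p
    obtain ⟨z, hz, hz'⟩ := IsMultiring.hadd_assoc _ _ _ _ _ (hw p) (hg p)
    obtain ⟨a, b, hb, rfl⟩ := p.exists_kfrac z
    rw [(h2 p hp2).2, (h3 p hp3).2] at hz
    rw [(h4 p hp4).2, (h1 p hp1).2] at hz'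
    obtain ⟨V, hV, hpV, hz⟩ := MSpec.mem_hadd_kfrac_nhds hz
    obtain ⟨V', hV', hpV', hz'⟩ := MSpec.mem_hadd_kfrac_nhds hz'
    refine ⟨U1 ∩ U2 ∩ (U3 ∩ U4) ∩ (V ∩ V'), ((hU1.inter hU2).inter (hU3.inter hU4)).inter
      (hV.inter hV'), ⟨⟨⟨hp1, hp2⟩, hp3, hp4⟩, hpV, hpV'⟩, a, b, fun q hq => ?_⟩
    obtain ⟨⟨⟨hq1, hq2⟩, hq3, hq4⟩, hqV, hqV'⟩ := hq
    rw [(h1 q hq1).2, (h2 q hq2).2, (h3 q hq3).2, (h4 q hq4).2]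
    obtain ⟨hb, _, _, h5⟩ := hz q hqV
    obtain ⟨_, _, _, h6⟩ := hz' q hqV'
    exact ⟨hb, h5, h6⟩
  hadd_comm s t := Set.ext fun u => forall_congr' fun p => by rw [IsMultiring.hadd_comm]
  mul_mem_hadd _ _ _ _ h p := IsMultiring.mul_mem_hadd _ _ _ _ (h p)

end VNHull

/-! ### Semi-real multirings -/

namespace SemiReal

variable {A : Type u} [MultiringStr A]

theorem of_order (σ : RealSpec A) : SemiReal A := by
  have key : ∀ (l : List A) (z : A), z ∈ listSum (l.map fun a => a ^ 2) → 0 ≤ σ z := by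
    intro l
    induction l with
    | nil =>
      rintro z rfl
      exact σ.map_zero.ge
    | cons a l ih =>
      rintro z ⟨w, hw, hz⟩
      refine SignType.nonneg_of_mem_hadd (σ.map_hadd _ _ _ hz) ?_ (ih w hw)
      change 0 ≤ σ (a ^ 2)
      rw [sq, σ.map_mul]
      generalize σ a = x
      revert x
      decide
  intro l hl
  have := key l _ hl
  rw [σ.map_neg, σ.map_one] at this
  exact absurd this (by decide)

/-- This is the Positivstellensatz for the preordering of sums of squares and the trivial
multiplicative set. -/
theorem exists_order [IsMultiring A] (hA : SemiReal A) : Nonempty (RealSpec A) := by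
  have hT : IsPreordering {z : A | SqSum 1 z} :=
    { add := fun _ ha _ hb _ hz => ha.add hb hz
      mul := fun _ ha _ hb => hb.sq_mul_left _ ha
      sq := SqSum.mul_self }
  obtain ⟨σ, -⟩ := hT.exists_order ⊥ (by
    intro s hs
    rw [Submonoid.mem_bot.1 hs]
    exact SqSum.one) (by
    intro s hs hcon
    rw [Submonoid.mem_bot.1 hs] at hcon
    have key : ∀ z : A, SqSum 1 z → ∃ l : List A, z ∈ listSum (l.map fun a => a ^ 2) := by
      intro z hz
      induction hz with
      | zero => exact ⟨[], rfl⟩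
      | cons hx _ hy ih =>
        obtain ⟨x, rfl⟩ := hx
        obtain ⟨l, hl⟩ := ih
        rw [mul_one, ← sq] at hy
        exact ⟨x :: l, _, hl, hy⟩
    obtain ⟨l, hl⟩ := key _ hcon
    exact hA l hl)
  exact ⟨σ⟩

end SemiReal

/-! ### Fractions and orders -/

namespace MSpec

variable {A : Type u} [MultiringStr A] [IsMultiring A]

theorem kfrac_eq_of_rel {p : MSpec A} {a b s t v : A} {hs : p ∈ D s} {ht : p ∈ D t} (hv : p ∈ D v)
    (h : p.1.Rel (a * t * v) (b * s * v)) : p.kfrac a s hs = p.kfrac b t ht := by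
  unfold kfrac
  rw [Localization.mk_eq_mk_iff, Localization.r_iff_exists]
  refine ⟨⟨p.1.toQuo v, fun h => hv (p.1.toQuo_eq_zero.1 h)⟩, ?_⟩
  have := (MIdeal.toQuo_eq _).2 h
  simp only [MIdeal.toQuo_mul] at this
  calc p.1.toQuo v * (p.1.toQuo t * p.1.toQuo a)
      = p.1.toQuo a * p.1.toQuo t * p.1.toQuo v := by ac_rfl
    _ = p.1.toQuo b * p.1.toQuo s * p.1.toQuo v := this
    _ = p.1.toQuo v * (p.1.toQuo s * p.1.toQuo b) := by ac_rfl

theorem kfrac_eq_of_mul_eq {p : MSpec A} {a b s t : A} {hs : p ∈ D s} {ht : p ∈ D t}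
    (h : a * t = b * s) : p.kfrac a s hs = p.kfrac b t ht :=
  kfrac_eq_of_rel p.one_mem_D (by
    rw [h]
    exact p.1.rel_refl _)

variable {B : Type v} [MultiringStr B] [IsMultiring B] (f : MultiringHom A B) (p : MSpec B)

theorem kMap_mul (x y : (comap f p).K) : kMap f p (x * y) = kMap f p x * kMap f p y :=
  map_mul ((Localization.monoidOf (comap f p).nonzero).map (quoMap_mem f p)
    (Localization.monoidOf p.nonzero)) x y

theorem kMap_one : kMap f p 1 = 1 :=
  map_one ((Localization.monoidOf (comap f p).nonzero).map (quoMap_mem f p)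
    (Localization.monoidOf p.nonzero))

theorem kMap_zero : kMap f p 0 = 0 := by
  rw [← kfrac_zero, kMap_kfrac, ← kfrac_zero]
  exact kfrac_eq_of_mul_eq (by rw [f.map_zero, zero_mul, zero_mul])

theorem kMap_neg (x : (comap f p).K) : kMap f p (-x) = -kMap f p x := by
  obtain ⟨a, b, hb, rfl⟩ := exists_kfrac _ x
  rw [kfrac_neg, kMap_kfrac, kMap_kfrac]
  change _ = p.kfrac (-f a) (f b) hb
  exact kfrac_eq_of_mul_eq (by rw [f.map_neg])

theorem kMap_hadd {x y z : (comap f p).K} (h : x ∈ y +ₘ z) :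
    kMap f p x ∈ kMap f p y +ₘ kMap f p z := by
  obtain ⟨a, s, hs, rfl⟩ := exists_kfrac _ x
  obtain ⟨b, t, ht, rfl⟩ := exists_kfrac _ y
  obtain ⟨c, u, hu, rfl⟩ := exists_kfrac _ z
  rw [kMap_kfrac, kMap_kfrac, kMap_kfrac]
  obtain ⟨v, hv, i, hi, z, hz, h⟩ := mem_hadd_kfrac_iff.1 h
  refine mem_hadd_kfrac_iff.2 ⟨f v, hv, f i, hi, f z, ?_, ?_⟩
  · simpa only [f.map_mul] using f.map_hadd _ _ _ hz
  · simpa only [f.map_mul] using f.map_hadd _ _ _ h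

end MSpec

namespace VNHull

variable {A : Type u} [MultiringStr A] [IsMultiring A]
variable {B : Type v} [MultiringStr B] [IsMultiring B]

theorem of_val (a : A) (p : MSpec A) : (of a).val p = p.kfrac a 1 p.one_mem_D := rfl

/-- The family equal to `1` on the clopen set `U` and to `0` outside of `U`. -/
noncomputable def indicator {U : Set (MSpec A)} (hU : IsClopen U) : VNHull A :=
  frac hU 1 1 fun p _ => p.one_mem_D

theorem indicator_of_mem {U : Set (MSpec A)} (hU : IsClopen U) {p : MSpec A} (hp : p ∈ U) :
    (indicator hU).val p = 1 := (frac_of_mem hU _ hp).trans p.kfrac_one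

theorem indicator_of_notMem {U : Set (MSpec A)} (hU : IsClopen U) {p : MSpec A} (hp : p ∉ U) :
    (indicator hU).val p = 0 := frac_of_notMem hU _ hp

/-- The morphism `V(f)`. -/
noncomputable def mapHom (f : MultiringHom A B) : MultiringHom (VNHull A) (VNHull B) where
  toFun := map f
  map_hadd _ _ _ h p := MSpec.kMap_hadd f p (h _)
  map_mul _ _ := VNHull.ext (funext fun p => MSpec.kMap_mul f p _ _)
  map_zero := VNHull.ext (funext fun p => MSpec.kMap_zero f p)
  map_one := VNHull.ext (funext fun p => MSpec.kMap_one f p)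
  map_neg _ := VNHull.ext (funext fun p => MSpec.kMap_neg f p _)

theorem map_val (f : MultiringHom A B) (s : VNHull A) (p : MSpec B) :
    (map f s).val p = MSpec.kMap f p (s.val (MSpec.comap f p)) := rfl

/-- The morphism `A → V(A)`. -/
noncomputable def ofHom (A : Type u) [MultiringStr A] [IsMultiring A] :
    MultiringHom A (VNHull A) where
  toFun := of
  map_hadd a b c h p := (MSpec.mem_hadd_kfrac_iff (hs := p.one_mem_D) (ht := p.one_mem_D)
    (hu := p.one_mem_D)).2 ⟨1, p.one_mem_D, 0, p.1.zero_mem, a,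
    by simpa using h, by simpa using mem_add_zero a⟩
  map_mul a b := VNHull.ext (funext fun p => by
    refine Eq.trans ?_ (p.kfrac_mul a 1 b 1 p.one_mem_D p.one_mem_D
      (MSpec.mul_mem_D p.one_mem_D p.one_mem_D)).symm
    exact MSpec.kfrac_eq_of_mul_eq (hs := p.one_mem_D) (by simp))
  map_zero := VNHull.ext (funext fun p => p.kfrac_zero)
  map_one := VNHull.ext (funext fun p => p.kfrac_one)
  map_neg a := rfl

end VNHull

/-! ### Orders of the von Neumann hull -/

namespace RealSpec

variable {A : Type u} [MultiringStr A]

/-- The support of an order, a prime ideal. -/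
def supp (σ : RealSpec A) : MSpec A where
  val :=
    { carrier := {a | σ a = 0}
      zero_mem := σ.map_zero
      hadd_subset := fun a ha b hb c hc => by
        have := σ.map_hadd _ _ _ hc
        rw [show σ a = 0 from ha, show σ b = 0 from hb] at this
        exact mem_zero_hadd.1 this
      mul_mem := fun a b hb => by
        change σ (a * b) = 0
        rw [σ.map_mul, show σ b = 0 from hb, mul_zero] }
  property := by
    refine ⟨fun h => ?_, fun a b h => ?_⟩
    · have h : σ 1 = 0 := h
      rw [σ.map_one] at h
      exact absurd h (by decide)
    · have h : σ (a * b) = 0 := h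
      rw [σ.map_mul] at h
      exact mul_eq_zero.1 h

theorem mem_supp {σ : RealSpec A} {a : A} : a ∈ σ.supp.1.carrier ↔ σ a = 0 := Iff.rfl

theorem supp_mem_D {σ : RealSpec A} {a : A} : σ.supp ∈ MSpec.D a ↔ σ a ≠ 0 := Iff.rfl

variable [IsMultiring A]

theorem eq_of_rel (σ : RealSpec A) {a b : A} (h : σ.supp.1.Rel a b) : σ a = σ b := by
  obtain ⟨i, hi, h⟩ := (MIdeal.rel_iff _).1 h
  have := σ.map_hadd _ _ _ h
  rwa [mem_supp.1 hi, mem_hadd_zero] at this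

/-- The sign map on the quotient by the support. -/
def quoSign (σ : RealSpec A) : σ.supp.1.Quo →* SignType where
  toFun := Quotient.lift (s := σ.supp.1.con.toSetoid) σ fun _ _ h => σ.eq_of_rel h
  map_one' := σ.map_one
  map_mul' x y := by
    obtain ⟨a, rfl⟩ := MIdeal.toQuo_surj x
    obtain ⟨b, rfl⟩ := MIdeal.toQuo_surj y
    exact σ.map_mul a b

theorem quoSign_ne_zero (σ : RealSpec A) (x : σ.supp.nonzero) : σ.quoSign x ≠ 0 := by
  obtain ⟨x, hx⟩ := x
  obtain ⟨a, rfl⟩ := MIdeal.toQuo_surj x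
  exact fun h => hx ((MIdeal.toQuo_eq_zero _).2 h)

/-- The sign map on the residue hyperfield of the support. -/
noncomputable def kSign (σ : RealSpec A) (x : σ.supp.K) : SignType :=
  Localization.liftOn x (fun a s => σ.quoSign a * σ.quoSign s) (by
    intro a c b d h
    obtain ⟨u, hu⟩ := Localization.r_iff_exists.1 h
    have := congrArg σ.quoSign hu
    simp only [map_mul] at this
    have h1 := σ.quoSign_ne_zero b
    have h2 := σ.quoSign_ne_zero d
    have h3 := σ.quoSign_ne_zero u
    revert this h1 h2 h3
    generalize σ.quoSign a = a
    generalize σ.quoSign b = b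
    generalize σ.quoSign c = c
    generalize σ.quoSign d = d
    generalize σ.quoSign u = u
    revert a b c d u
    decide)

theorem kSign_kfrac (σ : RealSpec A) (x y : A) (hy : σ.supp ∈ MSpec.D y) :
    σ.kSign (σ.supp.kfrac x y hy) = σ x * σ y := rfl

theorem kSign_mul (σ : RealSpec A) (x y : σ.supp.K) :
    σ.kSign (x * y) = σ.kSign x * σ.kSign y := by
  obtain ⟨a, s, hs, rfl⟩ := MSpec.exists_kfrac _ x
  obtain ⟨b, t, ht, rfl⟩ := MSpec.exists_kfrac _ y
  rw [MSpec.kfrac_mul _ _ _ _ _ _ _ (MSpec.mul_mem_D hs ht), kSign_kfrac, kSign_kfrac, kSign_kfrac,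
    σ.map_mul, σ.map_mul, mul_mul_mul_comm]

theorem kSign_hadd (σ : RealSpec A) {x y z : σ.supp.K} (h : x ∈ y +ₘ z) :
    σ.kSign x ∈ σ.kSign y +ₘ σ.kSign z := by
  obtain ⟨a, s, hs, rfl⟩ := MSpec.exists_kfrac _ x
  obtain ⟨b, t, ht, rfl⟩ := MSpec.exists_kfrac _ y
  obtain ⟨c, u, hu, rfl⟩ := MSpec.exists_kfrac _ z
  obtain ⟨v, hv, i, hi, z, hz, h⟩ := MSpec.mem_hadd_kfrac_iff.1 h
  rw [kSign_kfrac, kSign_kfrac, kSign_kfrac]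
  have h1 := σ.map_hadd _ _ _ h
  have h2 := σ.map_hadd _ _ _ hz
  rw [mem_supp.1 hi, mem_hadd_zero] at h1
  rw [← h1] at h2
  have sq : ∀ x : SignType, x ≠ 0 → x * x = 1 := by decide
  have hs := sq _ (supp_mem_D.1 hs)
  have ht := sq _ (supp_mem_D.1 ht)
  have hu := sq _ (supp_mem_D.1 hu)
  have hv := sq _ (supp_mem_D.1 hv)
  simp only [σ.map_mul] at h2
  refine mem_hadd_congr ?_ ?_ ?_ (mul_mem_hadd _ _ _ (σ s * σ t * σ u * σ v) h2)
  · calc _ = σ a * σ s * (σ t * σ t) * (σ u * σ u) * (σ v * σ v) := by ac_rfl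
      _ = _ := by rw [ht, hu, hv, mul_one, mul_one, mul_one]
  · calc _ = σ b * σ t * (σ s * σ s) * (σ u * σ u) * (σ v * σ v) := by ac_rfl
      _ = _ := by rw [hs, hu, hv, mul_one, mul_one, mul_one]
  · calc _ = σ c * σ u * (σ s * σ s) * (σ t * σ t) * (σ v * σ v) := by ac_rfl
      _ = _ := by rw [hs, ht, hv, mul_one, mul_one, mul_one]

/-- The order of `V(A)` induced by an order of `A`: the sign of the value at the support. -/
noncomputable def hullOrder (σ : RealSpec A) : RealSpec (VNHull A) where
  toFun s := σ.kSign (s.val σ.supp)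
  map_hadd _ _ _ h := σ.kSign_hadd (h _)
  map_mul _ _ := σ.kSign_mul _ _
  map_zero := by
    rw [VNHull.zero_val, ← MSpec.kfrac_zero, kSign_kfrac, σ.map_zero, zero_mul]
  map_one := by
    rw [VNHull.one_val, ← MSpec.kfrac_one, kSign_kfrac, σ.map_one, one_mul]
  map_neg s := by
    change σ.kSign (-s.val σ.supp) = -σ.kSign (s.val σ.supp)
    obtain ⟨a, b, hb, h⟩ := MSpec.exists_kfrac _ (s.val σ.supp)
    rw [h, MSpec.kfrac_neg, kSign_kfrac, kSign_kfrac, σ.map_neg, neg_mul]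

theorem hullOrder_of_eq {σ : RealSpec A} {s : VNHull A} {x y : A} {hy : σ.supp ∈ MSpec.D y}
    (h : s.val σ.supp = σ.supp.kfrac x y hy) : σ.hullOrder s = σ x * σ y :=
  congrArg σ.kSign h

/-- The order of `A` induced by an order of `V(A)`. -/
noncomputable def restrict (τ : RealSpec (VNHull A)) : RealSpec A := τ.comp (VNHull.ofHom A)

/-- It suffices to treat subbasic sets. If `τ` is nonzero at `a`, the indicator of `D(a)` has sign 1
because it fixes `a` under multiplication. If `τ` vanishes at `a`, that indicator is a multiple of
`a`, so it has sign 0 and the complementary one has sign 1. -/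
theorem map_indicator_eq_one (τ : RealSpec (VNHull A)) {U : Set (MSpec A)}
    (hU : U ∈ nhds τ.restrict.supp) :
    ∃ (V : Set (MSpec A)) (hV : IsClopen V), V ⊆ U ∧
      τ (VNHull.indicator hV) = 1 := by
  refine MSpec.nhds_induction (p := τ.restrict.supp)
    (P := fun U => ∃ (V : Set (MSpec A)) (hV : IsClopen V), V ⊆ U ∧
      τ (VNHull.indicator hV) = 1) ?_ ?_ ?_ ?_ ?_ hU
  · refine ⟨Set.univ, isClopen_univ, le_rfl, ?_⟩
    rw [← τ.map_one]
    congr 1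
    exact VNHull.ext (funext fun p => VNHull.indicator_of_mem _ trivial)
  · rintro U U' h ⟨V, hV, hVU, h1⟩
    exact ⟨V, hV, hVU.trans h, h1⟩
  · rintro U U' ⟨V, hV, hVU, h⟩ ⟨V', hV', hVU', h'⟩
    refine ⟨V ∩ V', hV.inter hV', Set.inter_subset_inter hVU hVU', ?_⟩
    have key : VNHull.indicator (hV.inter hV') = VNHull.indicator hV * VNHull.indicator hV' := by
      refine VNHull.ext (funext fun p => ?_)
      rw [VNHull.mul_val]
      by_cases hp : p ∈ V
      · by_cases hp' : p ∈ V'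
        · rw [VNHull.indicator_of_mem (hV.inter hV') ⟨hp, hp'⟩, VNHull.indicator_of_mem hV hp,
            VNHull.indicator_of_mem hV' hp', mul_one]
        · rw [VNHull.indicator_of_notMem (hV.inter hV') fun h => hp' h.2,
            VNHull.indicator_of_notMem hV' hp', mul_zero]
      · rw [VNHull.indicator_of_notMem (hV.inter hV') fun h => hp h.1,
          VNHull.indicator_of_notMem hV hp, zero_mul]
    rw [key, τ.map_mul, h, h', mul_one]
  · intro a ha
    have hD := MSpec.isClopen_D a
    refine ⟨MSpec.D a, hD, le_rfl, ?_⟩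
    have h : VNHull.of a * VNHull.indicator hD = VNHull.of a := by
      refine VNHull.ext (funext fun p => ?_)
      rw [VNHull.mul_val]
      by_cases hp : p ∈ MSpec.D a
      · rw [VNHull.indicator_of_mem hD hp, mul_one]
      · rw [VNHull.indicator_of_notMem hD hp, mul_zero, VNHull.of_val, ← MSpec.kfrac_zero]
        refine MSpec.kfrac_eq_of_rel p.one_mem_D ?_
        rw [← MIdeal.toQuo_eq]
        simp only [mul_one]
        exact ((MIdeal.toQuo_eq_zero _).2 (not_not.1 hp)).symm
    have h1 := congrArg τ h
    rw [τ.map_mul] at h1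
    have h2 : τ (VNHull.of a) ≠ 0 := ha
    revert h1 h2
    generalize τ (VNHull.indicator hD) = x
    generalize τ (VNHull.of a) = y
    revert x y
    decide
  · intro a ha
    have hD := MSpec.isClopen_D a
    refine ⟨(MSpec.D a)ᶜ, hD.compl, le_rfl, ?_⟩
    have h : VNHull.of a * VNHull.frac hD 1 a le_rfl = VNHull.indicator hD := by
      refine VNHull.ext (funext fun p => ?_)
      rw [VNHull.mul_val]
      by_cases hp : p ∈ MSpec.D a
      · rw [VNHull.frac_of_mem hD le_rfl hp, VNHull.indicator_of_mem hD hp, VNHull.of_val]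
        refine (p.kfrac_mul a 1 1 a _ _ (MSpec.mul_mem_D p.one_mem_D hp)).trans ?_
        rw [← MSpec.kfrac_one]
        exact MSpec.kfrac_eq_of_mul_eq (by simp)
      · rw [VNHull.frac_of_notMem hD le_rfl hp, VNHull.indicator_of_notMem hD hp, mul_zero]
    have h0 : τ (VNHull.indicator hD) = 0 := by
      rw [← h, τ.map_mul, show τ (VNHull.of a) = 0 from ha, zero_mul]
    have h1 : (1 : VNHull A) ∈ VNHull.indicator hD +ₘ VNHull.indicator hD.compl := by
      intro p
      rw [VNHull.one_val]
      by_cases hp : p ∈ MSpec.D a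
      · rw [VNHull.indicator_of_mem hD hp, VNHull.indicator_of_notMem hD.compl fun h => h hp]
        exact mem_add_zero _
      · rw [VNHull.indicator_of_notMem hD hp, VNHull.indicator_of_mem hD.compl hp]
        exact mem_comm (mem_add_zero _)
    have h2 := τ.map_hadd _ _ _ h1
    rw [h0, τ.map_one, mem_zero_hadd] at h2
    exact h2.symm

/-- Every order of `V(A)` is induced by an order of `A`. -/
theorem hullOrder_restrict (τ : RealSpec (VNHull A)) : τ.restrict.hullOrder = τ := by
  refine MultiringHom.ext fun s => ?_
  obtain ⟨U, hU, hp, x, y, h⟩ := s.constructible τ.restrict.supp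
  rw [hullOrder_of_eq (h _ hp).2]
  have hy := supp_mem_D.1 (h _ hp).1
  obtain ⟨V, hV, hVU, h1⟩ := τ.map_indicator_eq_one (hU.isOpen.mem_nhds hp)
  -- On `V` the family `s` is `x/y`; as the indicator has sign 1, `τ` sees the identity `s * y = x`
  -- globally.
  have key : s * VNHull.of y * VNHull.indicator hV = VNHull.of x * VNHull.indicator hV := by
    refine VNHull.ext (funext fun p => ?_)
    simp only [VNHull.mul_val]
    by_cases hp : p ∈ V
    · congr 1
      obtain ⟨hy, h⟩ := h p (hVU hp)
      rw [h, VNHull.of_val, VNHull.of_val]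
      refine (p.kfrac_mul x y y 1 _ _ (MSpec.mul_mem_D hy p.one_mem_D)).trans ?_
      exact MSpec.kfrac_eq_of_mul_eq (by simp)
    · rw [VNHull.indicator_of_notMem hV hp, mul_zero, mul_zero]
  have := congrArg τ key
  rw [τ.map_mul, τ.map_mul, τ.map_mul, h1, mul_one, mul_one] at this
  change τ s * τ.restrict y = τ.restrict x at this
  rw [← this, mul_assoc]
  revert hy
  generalize τ.restrict y = y
  generalize τ s = z
  revert y z
  decide

theorem hull_ext {τ τ' : RealSpec (VNHull A)} (h : ∀ a, τ (VNHull.of a) = τ' (VNHull.of a)) :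
    τ = τ' := by
  rw [← hullOrder_restrict τ, ← hullOrder_restrict τ']
  congr 1
  exact MultiringHom.ext h

/-- A neighbourhood of `p` contains all the supports at which some `b ∉ p` does not vanish and some
`c ∈ p` vanishes. -/
theorem exists_supp_mem {p : MSpec A} {U : Set (MSpec A)} (hU : U ∈ nhds p) :
    ∃ b, p ∈ MSpec.D b ∧ ∃ c ∈ p.1.carrier, ∀ σ : RealSpec A, σ b ≠ 0 → σ c = 0 → σ.supp ∈ U := by
  refine MSpec.nhds_induction (p := p) (P := fun U => ∃ b, p ∈ MSpec.D b ∧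
    ∃ c ∈ p.1.carrier, ∀ σ : RealSpec A, σ b ≠ 0 → σ c = 0 → σ.supp ∈ U) ?_ ?_ ?_ ?_ ?_ hU
  · exact ⟨1, p.one_mem_D, 0, p.1.zero_mem, fun _ _ _ => trivial⟩
  · rintro U V h ⟨b, hb, c, hc, hσ⟩
    exact ⟨b, hb, c, hc, fun σ h1 h2 => h (hσ σ h1 h2)⟩
  · rintro U V ⟨b, hb, c, hc, hσ⟩ ⟨b', hb', c', hc', hσ'⟩
    -- At an order, an element of a sum of two squares vanishes only if both squares do.
    obtain ⟨d, hd⟩ := hadd_nonempty (c * c) (c' * c')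
    refine ⟨b * b', MSpec.mul_mem_D hb hb', d, p.1.hadd_subset _ (p.1.mul_mem _ _ hc) _
      (p.1.mul_mem _ _ hc') hd, fun σ h1 h2 => ?_⟩
    rw [σ.map_mul] at h1
    have h3 := σ.map_hadd _ _ _ hd
    rw [h2, σ.map_mul, σ.map_mul] at h3
    have h4 : σ c = 0 ∧ σ c' = 0 := by
      revert h3
      generalize σ c = c
      generalize σ c' = c'
      revert c c'
      decide
    exact ⟨hσ σ (left_ne_zero_of_mul h1) h4.1, hσ' σ (right_ne_zero_of_mul h1) h4.2⟩
  · exact fun a ha => ⟨a, ha, 0, p.1.zero_mem, fun σ h _ => h⟩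
  · exact fun a ha => ⟨1, p.one_mem_D, a, ha, fun σ _ h => not_not.2 h⟩

end RealSpec

/-! ### The morphism `V(π) : V(A) → V(Q(A))` -/

namespace VNHull

variable {A : Type u} [MultiringStr A]

open RRQuot

/-- As `π` is surjective, every `D(â)` is the preimage of `D(a)`, so the topology on the spectrum of
`Q(A)` is induced from that of `A`. -/
theorem exists_comap_proj_preimage_subset {p : MSpec (RRQuot A)} {U : Set (MSpec (RRQuot A))}
    (hU : U ∈ nhds p) : ∃ V, IsClopen V ∧ MSpec.comap (proj A) p ∈ V ∧
      MSpec.comap (proj A) ⁻¹' V ⊆ U := by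
  refine MSpec.nhds_induction (p := p) (P := fun U => ∃ V, IsClopen V ∧
    MSpec.comap (proj A) p ∈ V ∧ MSpec.comap (proj A) ⁻¹' V ⊆ U) ?_ ?_ ?_ ?_ ?_ hU
  · exact ⟨Set.univ, isClopen_univ, trivial, le_rfl⟩
  · rintro U U' h ⟨V, hV, hp, hVU⟩
    exact ⟨V, hV, hp, hVU.trans h⟩
  · rintro U U' ⟨V, hV, hp, hVU⟩ ⟨V', hV', hp', hVU'⟩
    exact ⟨V ∩ V', hV.inter hV', ⟨hp, hp'⟩, Set.inter_subset_inter hVU hVU'⟩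
  · intro a ha
    obtain ⟨a, rfl⟩ := mk'_surjective a
    exact ⟨MSpec.D a, MSpec.isClopen_D a, ha, le_rfl⟩
  · intro a ha
    obtain ⟨a, rfl⟩ := mk'_surjective a
    exact ⟨(MSpec.D a)ᶜ, (MSpec.isClopen_D a).compl, not_not.2 ha, le_rfl⟩

variable [IsMultiring A]

/-- Near the preimage of `p`, `s = x/y` and `t = z/w`. For suitable `b ∉ p` and `c ∈ p`, all
supports where `b ≠ 0` and `c = 0` are in this neighbourhood, so `x * w * b` and `z * y * b` have
equal signs wherever `c` vanishes. Hence they are congruent modulo `p`. -/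
theorem map_proj_eq_of_sign_eq {s t : VNHull A}
    (h : ∀ τ : RealSpec (VNHull A), τ s = τ t) : map (proj A) s = map (proj A) t := by
  refine VNHull.ext (funext fun p => ?_)
  obtain ⟨U, hU, hp, x, y, hs⟩ := s.constructible (MSpec.comap (proj A) p)
  obtain ⟨V, hV, hp', z, w, ht⟩ := t.constructible (MSpec.comap (proj A) p)
  obtain ⟨b, hb, c, hc, hσ⟩ := RealSpec.exists_supp_mem
    (Filter.inter_mem (hU.isOpen.mem_nhds hp) (hV.isOpen.mem_nhds hp'))
  rw [map_val, map_val, (hs _ hp).2, (ht _ hp').2, MSpec.kMap_kfrac, MSpec.kMap_kfrac]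
  refine MSpec.kfrac_eq_of_rel (v := mk' b) hb ?_
  obtain ⟨j, hj⟩ := hadd_nonempty (mk' x * mk' w * mk' b) (-(mk' z * mk' y * mk' b))
  -- The factor puts the difference into `p`. It stays a difference: where `c` vanishes the two
  -- terms agree and 0 is allowed, elsewhere `c * c` has sign 1.
  refine ⟨j * mk' (c * c), mem_hadd_iff.2 fun σ => ?_, ?_⟩
  · have hj := mem_hadd_iff.1 hj σ
    have key : σ c = 0 → σ x * σ w * σ b = σ z * σ y * σ b := by
      intro h0
      by_cases h1 : σ b = 0
      · rw [h1, mul_zero, mul_zero]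
      · obtain ⟨hσU, hσV⟩ := hσ σ h1 h0
        have h2 := h σ.hullOrder
        obtain ⟨hy, hs⟩ := hs _ hσU
        obtain ⟨hw, ht⟩ := ht _ hσV
        rw [RealSpec.hullOrder_of_eq hs, RealSpec.hullOrder_of_eq ht] at h2
        have hy := RealSpec.supp_mem_D.1 hy
        have hw := RealSpec.supp_mem_D.1 hw
        revert h2 hy hw
        clear * -
        generalize σ x = x
        generalize σ y = y
        generalize σ z = z
        generalize σ w = w
        generalize σ b = b
        intro h2 hy hw
        congr 1
        revert x y z w
        decide
    change j.val σ ∈ (σ x * σ w * σ b) +ₘ -(σ z * σ y * σ b) at hj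
    change j.val σ * σ (c * c) ∈ (σ x * σ w * σ b) +ₘ -(σ z * σ y * σ b)
    rw [σ.map_mul c c]
    revert key hj
    generalize (σ x * σ w * σ b) = x
    generalize (σ z * σ y * σ b) = z
    generalize σ c = c
    generalize j.val σ = j
    revert x z c j
    decide
  · rw [show mk' (c * c) = mk' c * mk' c from (proj A).map_mul c c]
    exact p.1.mul_mem _ _ (p.1.mul_mem _ _ hc)

/-- A local fraction of `t` lifts to a fraction over a clopen set of primes of `A`, and finitely
many lifts are glued there. These sets only have to cover the image of the spectrum of `Q(A)`. -/
theorem map_proj_surjective (t : VNHull (RRQuot A)) : ∃ s, map (proj A) s = t := by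
  obtain ⟨W, -, hW, s, hs⟩ := isCompact_univ.induction_on
    (p := fun V : Set (MSpec (RRQuot A)) => ∃ W : Set (MSpec A), IsClopen W ∧
      V ⊆ MSpec.comap (proj A) ⁻¹' W ∧
      ∃ s : VNHull A, ∀ p, MSpec.comap (proj A) p ∈ W → (map (proj A) s).val p = t.val p)
    ⟨∅, isClopen_empty, Set.empty_subset _, 0, fun _ h => h.elim⟩
    (fun _ _ h ⟨W, hW, hV, hs⟩ => ⟨W, hW, h.trans hV, hs⟩)
    (fun _ _ ⟨W, hW, hV, s, hs⟩ ⟨W', hW', hV', s', hs'⟩ =>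
      ⟨W ∪ W', hW.union hW', Set.union_subset_union hV hV', piecewise hW s s', fun p hp => by
        rw [map_val]
        by_cases hpW : MSpec.comap (proj A) p ∈ W
        · rw [piecewise_of_mem hW _ _ hpW]
          exact hs p hpW
        · rw [piecewise_of_notMem hW _ _ hpW]
          exact hs' p (hp.resolve_left hpW)⟩)
    (fun p _ => by
      obtain ⟨U, hU, hp, x, y, h⟩ := t.constructible p
      obtain ⟨x, rfl⟩ := mk'_surjective x
      obtain ⟨y, rfl⟩ := mk'_surjective y
      obtain ⟨V, hV, hpV, hVU⟩ := exists_comap_proj_preimage_subset (hU.isOpen.mem_nhds hp)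
      have hVy := hV.inter (MSpec.isClopen_D y)
      refine ⟨MSpec.comap (proj A) ⁻¹' (V ∩ MSpec.D y), mem_nhdsWithin_of_mem_nhds
        ((hVy.preimage (MSpec.continuous_comap _)).isOpen.mem_nhds ⟨hpV, (h p hp).1⟩), _, hVy, le_rfl,
        frac hVy x y Set.inter_subset_right, fun q hq => ?_⟩
      rw [map_val, frac_of_mem _ _ hq, MSpec.kMap_kfrac, (h q (hVU hq.1)).2]
      rfl)
  exact ⟨s, VNHull.ext (funext fun p => hs p (hW trivial))⟩

/-- Every order of `V(A)` factors through `V(Q(A))`. -/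
theorem exists_order_comp_map_proj (τ : RealSpec (VNHull A)) :
    ∃ τ' : RealSpec (VNHull (RRQuot A)), ∀ s, τ' (map (proj A) s) = τ s := by
  -- The order is restricted to `A`, passed to `Q(A)` and extended to `V(Q(A))`; pulled back, it
  -- agrees with `τ` on `A`, hence everywhere.
  refine ⟨(order τ.restrict).hullOrder, fun s => ?_⟩
  have : (order τ.restrict).hullOrder.comp (mapHom (proj A)) = τ := by
    refine RealSpec.hull_ext fun a => ?_
    change (order τ.restrict).hullOrder (map (proj A) (of a)) = τ (of a)
    rw [map_of, RealSpec.hullOrder_of_eq (x := proj A a) (y := 1) (hy := MSpec.one_mem_D _) rfl,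
      (order τ.restrict).map_one, mul_one]
    rfl
  exact congrArg (fun f => f.toFun s) this

theorem map_proj_eq_iff {s t : VNHull A} :
    map (proj A) s = map (proj A) t ↔ proj (VNHull A) s = proj (VNHull A) t := by
  refine ⟨fun h => mk'_eq.2 fun τ => ?_, fun h => map_proj_eq_of_sign_eq (mk'_eq.1 h)⟩
  obtain ⟨τ', hτ⟩ := exists_order_comp_map_proj τ
  rw [← hτ, ← hτ, h]

/-- The morphism `Q(V(A)) → V(Q(A))` induced by `V(π)`. -/
noncomputable def quotHullHom (A : Type u) [MultiringStr A] [IsMultiring A] :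
    MultiringHom (RRQuot (VNHull A)) (VNHull (RRQuot A)) :=
  let F : RRQuot (VNHull A) → VNHull (RRQuot A) := fun x =>
    map (proj A) (mk'_surjective x).choose
  have hF : ∀ s, F (mk' s) = map (proj A) s := fun s =>
    map_proj_eq_iff.2 (mk'_surjective (mk' s)).choose_spec
  { toFun := F
    map_hadd := by
      rintro _ _ _ ⟨a, b, c, rfl, rfl, rfl, h⟩
      rw [hF, hF, hF]
      exact (mapHom (proj A)).map_hadd _ _ _ h
    map_mul := fun x y => by
      obtain ⟨s, rfl⟩ := mk'_surjective x
      obtain ⟨t, rfl⟩ := mk'_surjective y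
      rw [hF, hF]
      exact ((congrArg F ((proj (VNHull A)).map_mul s t)).symm.trans (hF _)).trans
        ((mapHom (proj A)).map_mul s t)
    map_zero := (hF 0).trans (mapHom (proj A)).map_zero
    map_one := (hF 1).trans (mapHom (proj A)).map_one
    map_neg := fun x => by
      obtain ⟨s, rfl⟩ := mk'_surjective x
      rw [hF]
      exact ((congrArg F ((proj (VNHull A)).map_neg s)).symm.trans (hF _)).trans
        ((mapHom (proj A)).map_neg s) }

theorem quotHullHom_proj (s : VNHull A) :
    quotHullHom A (proj (VNHull A) s) = map (proj A) s :=
  map_proj_eq_iff.2 (mk'_surjective (mk' s)).choose_spec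

/-- The inverse sends `t` to the class of any preimage under `V(π)`. It preserves sums because these
are tested at orders of `V(A)`, each of which factors through `V(π)`. -/
theorem isIso_of_comp_proj (f : MultiringHom (RRQuot (VNHull A)) (VNHull (RRQuot A)))
    (hf : ∀ s, f (proj (VNHull A) s) = map (proj A) s) : f.IsIso := by
  choose g hg using map_proj_surjective (A := A)
  have eq_g : ∀ s t, map (proj A) s = t → proj (VNHull A) s = proj (VNHull A) (g t) :=
    fun s t h => map_proj_eq_iff.1 (h.trans (hg t).symm)
  have hadd : ∀ a b c, a ∈ b +ₘ c →
      proj (VNHull A) (g a) ∈ proj (VNHull A) (g b) +ₘ proj (VNHull A) (g c) := by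
    refine fun a b c h => mem_hadd_iff.2 fun τ => ?_
    obtain ⟨τ', hτ⟩ := exists_order_comp_map_proj τ
    change τ (g a) ∈ τ (g b) +ₘ τ (g c)
    rw [← hτ, ← hτ, ← hτ, hg, hg, hg]
    exact τ'.map_hadd _ _ _ h
  let G : MultiringHom (VNHull (RRQuot A)) (RRQuot (VNHull A)) :=
    { toFun := fun t => proj (VNHull A) (g t)
      map_hadd := hadd
      map_mul := fun a b => by
        rw [← (proj _).map_mul]
        refine (eq_g _ _ (((mapHom (proj A)).map_mul _ _).trans ?_)).symm
        exact congrArg₂ _ (hg a) (hg b)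
      map_zero := by
        rw [← (proj _).map_zero]
        exact (eq_g _ _ (mapHom (proj A)).map_zero).symm
      map_one := by
        rw [← (proj _).map_one]
        exact (eq_g _ _ (mapHom (proj A)).map_one).symm
      map_neg := fun a => by
        rw [← (proj _).map_neg]
        exact (eq_g _ _ (((mapHom (proj A)).map_neg _).trans (congrArg _ (hg a)))).symm }
  refine ⟨G, fun x => ?_, fun t => (hf _).trans (hg t)⟩
  obtain ⟨s, rfl⟩ := mk'_surjective x
  exact (eq_g s _ (hf s).symm).symm

end VNHull

theorem mainTheorem3 (A : Type u) [MultiringStr A] [IsMultiring A] (hA : SemiReal A) :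
    ∃ (_ : IsMultiring (RRQuot A)) (_ : IsMultiring (VNHull A))
      (_ : IsMultiring (RRQuot (VNHull A))) (_ : IsMultiring (VNHull (RRQuot A))),
      SemiReal (VNHull A) ∧
      (∃! f : MultiringHom (RRQuot (VNHull A)) (VNHull (RRQuot A)),
        ∀ s : VNHull A, f (RRQuot.proj (VNHull A) s) = VNHull.map (RRQuot.proj A) s) ∧
      ∀ f : MultiringHom (RRQuot (VNHull A)) (VNHull (RRQuot A)),
        (∀ s : VNHull A, f (RRQuot.proj (VNHull A) s) = VNHull.map (RRQuot.proj A) s) →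
        f.IsIso := by
  refine ⟨inferInstance, inferInstance, inferInstance, inferInstance, ?_,
    ⟨VNHull.quotHullHom A, VNHull.quotHullHom_proj, fun f hf => ?_⟩, VNHull.isIso_of_comp_proj⟩
  · obtain ⟨σ⟩ := hA.exists_order
    exact SemiReal.of_order σ.hullOrder
  · refine MultiringHom.ext fun x => ?_
    obtain ⟨s, rfl⟩ := RRQuot.mk'_surjective x
    exact (hf s).trans (VNHull.quotHullHom_proj s).symm
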